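/- Let $\mathcal{O}$ be a Noetherian integrally closed domain with field of fractions $F$, let $K$ be a finite Galois extension of $F$, and let $A$ be an $\mathcal{O}$-algebra that is free of finite rank as an $\mathcal{O}$-module. A *symmetrizing form* on $A$ is an $\mathcal{O}$-linear map $t:A\to\mathcal{O}$ with $t(ab)=t(ba)$ for all $a,b\in A$ such that $a\mapsto(x\mapsto t(ax))$ is an isomorphism $A\to\mathrm{Hom}_{\mathcal{O}}(A,\mathcal{O})$. Let $t$ be a symmetrizing form on $A$, let $\bar A\subseteq A$ be a subalgebra and $G$ a finite cyclic group, and assume that $(A,t)$ is the twisted symmetric algebra of $G$ over $\bar A$. This means the following: - $\bar A$ is free of finite rank over $\mathcal{O}$, $\bar t:=t|_{\bar A}$ is a symmetrizing form on $\bar A$, and $A$ is free of finite rank as a left $\bar A$-module; - there is given a family $(A_g)_{g\in G}$ of $\mathcal{O}$-submodules of $A$ with $A=\bigoplus_{g\in G}A_g$, $A_gA_h=A_{gh}$ for all $g,h\in G$, $A_1=\bar A$, $t(A_g)=0$ for $g\neq 1$, and such that every $A_g$ contains a unit of $A$. Write $KA:=K\otimes_{\mathcal{O}}A$ and $K\bar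 A:=K\otimes_{\mathcal{O}}\bar A\subseteq KA$, and assume that the $K$-algebras $KA$, $K\bar A$ and $KG$ are split semisimple. Let $\mathrm{Irr}(\cdot)$ denote the set of ($K$-valued) characters of simple modules. For $\chi\in\mathrm{Irr}(KA)$ let $e(\chi)$ be the central primitive idempotent of $KA$ that acts as the identity on the simple module with character $\chi$ and as $0$ on the other simple modules. Let $s_\chi\in K$ be the Schur element of $\chi$ with respect to $t$, that is, the scalar by which the central element $\chi^\vee\in KA$ defined by $t^K(\chi^\vee a)=\chi(a)$ for all $a\in KA$ acts on the simple module with character $\chi$, where $t^K$ is the $K$-linear extension of $t$. Define $\bar e(\bar\chi)$ and $s_{\bar\chi}$ likewise for $\bar\chi\in\mathrm{Irr}(K\bar A)$, using $\bar t$. The group $G$ acts on the centre of $K\bar A$: for $z$ in the centre, $g(z)$ is the unique element of $K\bar A$ with $g(z)a=az$ for all $a\in A_g$. It acts on $\mathrm{Irr}(K\bar A)$ by $\bar e(g(\bar\chi))=g(\bar e(\bar\chi))$. The group $G^\vee:=\mathrm{Hom}(G,K^\times)$ acts on $\mathrm{Irr}(KA)$ by $(\chi\cdot\xi)(a)=\chi(a)\xi(g)$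 for $\xi\in G^\vee$, $g\in G$ and $a\in A_g$. Then there is a bijection $\bar\Omega\leftrightarrow\Omega$ between the set $\mathrm{Irr}(K\bar A)/G$ of $G$-orbits and the set $\mathrm{Irr}(KA)/G^\vee$ of $G^\vee$-orbits such that, whenever $\bar\Omega$ and $\Omega$ correspond to each other, $$\sum_{\bar\chi\in\bar\Omega}\bar e(\bar\chi)=\sum_{\chi\in\Omega}e(\chi),\qquad |\bar\Omega|\,|\Omega|=|G|,$$ $$\mathrm{Res}^{KA}_{K\bar A}(\chi)=\sum_{\bar\chi\in\bar\Omega}\bar\chi\ \text{ for all }\chi\in\Omega,\qquad \mathrm{Ind}^{KA}_{K\bar A}(\bar\chi)=\sum_{\chi\in\Omega}\chi\ \text{ for all }\bar\chi\in\bar\Omega,$$ where $\mathrm{Ind}^{KA}_{K\bar A}(\bar\chi)$ is the character of $KA\otimes_{K\bar A}\bar X$ for a simple $K\bar A$-module $\bar X$ with character $\bar\chi$. Moreover, for all $\chi\in\Omega$ and $\bar\chi\in\bar\Omega$, $$s_\chi=|\Omega|\,s_{\bar\chi}.$$ -/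

import Mathlib

open scoped TensorProduct

noncomputable section

namespace Clifford

universe u v

/-! ### Characters, central morphisms and blocks of a finite-dimensional algebra over a field -/

section Algebra

variable (K : Type v) [Field K] (B : Type u) [Ring B] [Algebra K B]

/-- The character of a `B`-module `V`: `b ↦ tr (v ↦ b • v)`. -/
def character (V : Type*) [AddCommGroup V] [Module K V] [Module B V] [IsScalarTower K B V] :
    Module.Dual K B :=
  (LinearMap.trace K V) ∘ₗ (Algebra.lsmul K K V : B →ₐ[K] Module.End K V).toLinearMap

/-- The set of irreducible characters of `B`, i.e. of characters of simple `B`-modules.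
(Every simple module is a quotient of `B`, so the universe of `B` contains them all.) -/
def Irr : Set (Module.Dual K B) :=
  {χ | ∃ (V : Type u) (_ : AddCommGroup V) (_ : Module K V) (_ : Module B V)
    (_ : IsScalarTower K B V), IsSimpleModule B V ∧ character K B V = χ}

/-- `B` is split semisimple: semisimple, and the only endomorphisms of a simple `B`-module
are the scalars of `K`. -/
def IsSplitSemisimple : Prop :=
  IsSemisimpleRing B ∧
    ∀ (V : Type u) [AddCommGroup V] [Module K V] [Module B V] [IsScalarTower K B V]
      [IsSimpleModule B V] (f : V →ₗ[B] V), ∃ c : K, ∀ v : V, f v = c • v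

variable {K B}

/-- `e` is the element of `B ≃ ∏ M_χ'` whose `χ`-component is `1` and whose other components
are `0`. -/
def IsBlockOf (χ : Module.Dual K B) (e : B) : Prop :=
  ∀ (V : Type u) [AddCommGroup V] [Module K V] [Module B V] [IsScalarTower K B V]
    [IsSimpleModule B V],
    (character K B V = χ → ∀ v : V, e • v = v) ∧ (character K B V ≠ χ → ∀ v : V, e • v = 0)

/-- The block-idempotent `e(χ)` of a semisimple algebra. -/
def block (χ : Module.Dual K B) : B :=
  Classical.epsilon (IsBlockOf χ)

/-- `c` is the scalar by which the (central) element `z` acts on the simple module of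
character `χ`. -/
def IsCentralValue (χ : Module.Dual K B) (z : B) (c : K) : Prop :=
  ∀ (V : Type u) [AddCommGroup V] [Module K V] [Module B V] [IsScalarTower K B V]
    [IsSimpleModule B V], character K B V = χ → ∀ v : V, z • v = c • v

/-- The central morphism `ω_χ`. -/
def centralValue (χ : Module.Dual K B) (z : B) : K :=
  Classical.epsilon (IsCentralValue χ z)

end Algebra

/-! ### Symmetric algebras and Schur elements -/

section Symmetric

variable {R : Type*} [CommRing R] {A : Type*} [Ring A] [Algebra R A]

/-- The map `a ↦ (x ↦ t (a x))`. -/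
def hat (t : A →ₗ[R] R) : A →ₗ[R] Module.Dual R A :=
  (LinearMap.mul R A).compr₂ t

/-- `t` is a trace function inducing an isomorphism between `A` and its dual. -/
structure IsSymmetrizingForm (t : A →ₗ[R] R) : Prop where
  trace : ∀ a b : A, t (a * b) = t (b * a)
  bijective : Function.Bijective (hat t)

/-- `S` is a symmetric subalgebra of `(A, t)`. Here `A` is an `S`-module by left
multiplication. -/
structure IsSymmetricSubalgebra (t : A →ₗ[R] R) (S : Subalgebra R A) : Prop where
  free_base : Module.Free R S
  finite_base : Module.Finite R S
  symmetrizing : IsSymmetrizingForm (t ∘ₗ S.val.toLinearMap)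
  free : Module.Free S A
  finite : Module.Finite S A

/-- The element `τ^∨` with `t (τ^∨ a) = τ a` for all `a`. -/
def dualElement (t : A →ₗ[R] R) (τ : Module.Dual R A) : A :=
  Function.invFun (hat t) τ

/-- The extension of scalars `t^K` of the form `t`. -/
def formExt (K : Type*) [Field K] [Algebra R K] (t : A →ₗ[R] R) :
    (K ⊗[R] A) →ₗ[K] K :=
  (TensorProduct.AlgebraTensorModule.rid R K K).toLinearMap ∘ₗ t.baseChange K

/-- The Schur element `s_χ = ω_χ (χ^∨)` of `χ ∈ Irr (KA)` with respect to `t`. -/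
def schurElement {K : Type*} [Field K] [Algebra R K] (t : A →ₗ[R] R)
    (χ : Module.Dual K (K ⊗[R] A)) : K :=
  centralValue χ (dualElement (formExt K t) χ)

end Symmetric

/-! ### Induced modules -/

section Induction

variable {K : Type*} [Field K] {C B : Type*} [Ring C] [Algebra K C] [Ring B] [Algebra K B]

/-- The relations `b ι(c) ⊗ v = b ⊗ c v` that define `B ⊗_C V` as a quotient of `B ⊗_K V`. -/
def indRelations (ι : C →ₐ[K] B) (V : Type*) [AddCommGroup V] [Module K V] [Module C V] :
    Submodule B (B ⊗[K] V) :=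
  Submodule.span B {z | ∃ (b : B) (c : C) (v : V), z = (b * ι c) ⊗ₜ[K] v - b ⊗ₜ[K] (c • v)}

/-- The induced `B`-module `B ⊗_C V`, where `B` is a right `C`-module through `ι`. -/
abbrev Ind (ι : C →ₐ[K] B) (V : Type*) [AddCommGroup V] [Module K V] [Module C V] : Type _ :=
  (B ⊗[K] V) ⧸ indRelations ι V

end Induction

/-! ### Twisted symmetric algebras of a finite group -/

section Twisted

variable {R : Type*} [CommRing R] {A : Type*} [Ring A] [Algebra R A] {G : Type*} [Group G]

/-- `(A, t)` is the twisted symmetric algebra of `G` over the subalgebra `S`, with the family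
`(A_g)` of submodules. -/
structure IsTwistedSymmetricAlgebra [DecidableEq G] (t : A →ₗ[R] R) (S : Subalgebra R A)
    (𝒜 : G → Submodule R A) : Prop where
  symmetrizing : IsSymmetrizingForm t
  subalgebra : IsSymmetricSubalgebra t S
  directSum : DirectSum.IsInternal 𝒜
  mul : ∀ g h : G, 𝒜 g * 𝒜 h = 𝒜 (g * h)
  one : 𝒜 1 = Subalgebra.toSubmodule S
  form_eq_zero : ∀ g : G, g ≠ 1 → ∀ a ∈ 𝒜 g, t a = 0
  exists_unit : ∀ g : G, ∃ a ∈ 𝒜 g, IsUnit a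

variable (K : Type*) [Field K] [Algebra R K]

/-- The inclusion of `KS` in `KA`. -/
def incl (S : Subalgebra R A) : (K ⊗[R] S) →ₐ[K] (K ⊗[R] A) :=
  Algebra.TensorProduct.map (AlgHom.id K K) S.val

variable {K}

/-- `z' = g(z)`, where `g(z)` is the element of `KS` with `g(z) a = a z` for all `a ∈ K A_g`
(it is enough to let `a` run through `A_g`). -/
def IsTranslate (S : Subalgebra R A) (𝒜 : G → Submodule R A) (g : G) (z z' : K ⊗[R] S) : Prop :=
  ∀ a ∈ 𝒜 g, incl K S z' * ((1 : K) ⊗ₜ[R] a) = ((1 : K) ⊗ₜ[R] a) * incl K S z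

/-- The orbit of `χ` under the action of `G` on `Irr (KS)`, where `g(χ)` is the irreducible
character whose block is `g(e(χ))`. -/
def orbit (S : Subalgebra R A) (𝒜 : G → Submodule R A) (χ : Module.Dual K (K ⊗[R] S)) :
    Set (Module.Dual K (K ⊗[R] S)) :=
  {ψ | ψ ∈ Irr K (K ⊗[R] S) ∧ ∃ g : G, IsTranslate S 𝒜 g (block χ) (block ψ)}

/-- `ψ = χ · ξ`, i.e. `ψ(a) = χ(a) ξ(g)` for all `g` and all `a ∈ A_g`; as the `A_g` span `KA`
over `K`, this determines `ψ`. -/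
def IsTwist (𝒜 : G → Submodule R A) (ξ : G →* Kˣ) (χ ψ : Module.Dual K (K ⊗[R] A)) : Prop :=
  ∀ g : G, ∀ a ∈ 𝒜 g, ψ ((1 : K) ⊗ₜ[R] a) = χ ((1 : K) ⊗ₜ[R] a) * (ξ g : K)

/-- The orbit of `χ` under the action `χ ↦ χ · ξ` of `G^∨ = Hom(G, K^×)` on `Irr (KA)`. -/
def dualOrbit (𝒜 : G → Submodule R A) (χ : Module.Dual K (K ⊗[R] A)) :
    Set (Module.Dual K (K ⊗[R] A)) :=
  {ψ | ψ ∈ Irr K (K ⊗[R] A) ∧ ∃ ξ : G →* Kˣ, IsTwist 𝒜 ξ χ ψ}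

variable (K)

/-- The set `Irr (KS) / G` of orbits. -/
def Orbits (S : Subalgebra R A) (𝒜 : G → Submodule R A) :
    Set (Set (Module.Dual K (K ⊗[R] S))) :=
  orbit S 𝒜 '' Irr K (K ⊗[R] S)

/-- The set `Irr (KA) / G^∨` of orbits. -/
def DualOrbits (𝒜 : G → Submodule R A) : Set (Set (Module.Dual K (K ⊗[R] A))) :=
  dualOrbit 𝒜 '' Irr K (K ⊗[R] A)

end Twisted

end Clifford

end

universe w₁ w₂

/-!
Let `C = KS` and `B = KA`, so that `B` is graded by `G` with `C` in degree `1` and a unit in every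
degree. For a simple `B`-module `V`, conjugation by homogeneous units permutes the constituents of
`Res V` transitively. Averaging over `G` against linear characters splits `E = End_C (Res V)` into
spaces of `B`-endomorphisms twisted by some `ξ ∈ G^∨`; by Schur's lemma each of them has dimension
`1` if `ξ` fixes the character `χ` of `V`, and `0` otherwise. As the stabilizer of `χ` is cyclic,
`E` is generated by a single element. Hence `E` is commutative, `Res V` is multiplicity free, and
its number of constituents is `dim E = |Stab χ|`, which gives `|Ω̄| |Ω| = |G|`.

Summing `χ · ξ` over the orbit of `χ` gives `|Ω|` times the composition of `χ` with the projection
of `B` onto degree `1`. Comparing with the restriction of `χ` yields the induction formula and,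
through the symmetrizing forms, the relation between the Schur elements. The roots of unity that
make the linear characters separate the elements of `G` are present because `KG` is split.
-/

noncomputable section

namespace Clifford

universe u v

section SplitSemisimple

variable {K : Type v} [Field K] {B : Type u} [Ring B] [Algebra K B]

section Character

variable {V W : Type*} [AddCommGroup V] [Module K V] [Module B V] [IsScalarTower K B V]
  [AddCommGroup W] [Module K W] [Module B W] [IsScalarTower K B W]

theorem character_apply (b : B) :
    character K B V b = LinearMap.trace K V (Algebra.lsmul K K V b) := rfl

theorem character_congr (e : V ≃ₗ[B] W) : character K B V = character K B W := by
  ext b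
  rw [character_apply, character_apply, ← LinearMap.trace_conj' _ (e.restrictScalars K)]
  congr 1
  ext w
  simp [LinearEquiv.conj_apply]

theorem character_mul_comm (a b : B) : character K B V (a * b) = character K B V (b * a) := by
  rw [character_apply, character_apply, map_mul (Algebra.lsmul K K V),
    map_mul (Algebra.lsmul K K V), LinearMap.trace_mul_comm]

theorem character_mul_of_smul_eq_self {e : B} (he : ∀ v : V, e • v = v) (b : B) :
    character K B V (e * b) = character K B V b := by
  rw [character_apply, character_apply]
  congr 1
  ext v
  simp [he]

theorem character_mul_of_smul_eq_zero {e : B} (he : ∀ v : V, e • v = 0) (b : B) :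
    character K B V (e * b) = 0 := by
  have hlsmul : Algebra.lsmul K K V (e * b) = 0 := by
    ext v
    simp [he]
  rw [character_apply, hlsmul, map_zero]

variable (K) in
theorem finite_of_isSimpleModule [Module.Finite K B] [IsSimpleModule B V] : Module.Finite K V :=
  Module.Finite.trans B V

end Character

theorem mul_comm_of_mem_irr {χ : Module.Dual K B} (hχ : χ ∈ Irr K B) (a b : B) :
    χ (a * b) = χ (b * a) := by
  obtain ⟨V, _, _, _, _, _, rfl⟩ := hχ
  exact character_mul_comm a b

theorem eq_zero_of_forall_simple [IsSemisimpleRing B] {b : B}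
    (h : ∀ (V : Type u) [AddCommGroup V] [Module K V] [Module B V] [IsScalarTower K B V]
      [IsSimpleModule B V], ∀ v : V, b • v = 0) : b = 0 := by
  suffices b ∈ Ring.jacobson B by simpa [IsSemisimpleRing.jacobson_eq_bot] using this
  rw [Ring.jacobson_eq_sInf_isMaximal, Ideal.mem_sInf]
  intro m hm
  have : IsSimpleModule B (B ⧸ m) := isSimpleModule_iff_isCoatom.2 (Ideal.isMaximal_def.1 hm)
  simpa [← Submodule.Quotient.mk_smul] using h (B ⧸ m) (Submodule.Quotient.mk 1)

section IsotypicComponent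

variable {V W : Type*} [AddCommGroup V] [Module B V] [IsSimpleModule B V]
  [AddCommGroup W] [Module B W] [IsSimpleModule B W]

theorem smul_eq_zero_of_mem_isotypicComponent (hVW : IsEmpty (V ≃ₗ[B] W)) {b : B}
    (hb : b ∈ isotypicComponent B B V) (w : W) : b • w = 0 := by
  suffices isotypicComponent B B V ≤ LinearMap.ker (LinearMap.toSpanSingleton B W w) by
    simpa using this hb
  refine sSup_le fun m ⟨e⟩ x hx => ?_
  have : IsSimpleModule B m := IsSimpleModule.congr e
  rcases LinearMap.bijective_or_eq_zero
    ((LinearMap.toSpanSingleton B W w).comp m.subtype) with hbij | hzero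
  · exact hVW.elim (e.symm.trans (LinearEquiv.ofBijective _ hbij))
  · simpa using LinearMap.congr_fun hzero ⟨x, hx⟩

theorem smul_eq_zero_of_disjoint_isotypicComponent [IsSemisimpleRing B] {J : Ideal B}
    (hJ : Disjoint (isotypicComponent B B V) J) {b : B} (hb : b ∈ J) (v : V) : b • v = 0 := by
  by_contra hne
  let φ : J →ₗ[B] V := (LinearMap.toSpanSingleton B V v).comp J.subtype
  have hφ : φ ≠ 0 := fun h => hne (by simpa [φ] using LinearMap.congr_fun h ⟨b, hb⟩)
  obtain ⟨S, ⟨e⟩⟩ := LinearMap.linearEquiv_of_ne_zero hφ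
  let eS : S ≃ₗ[B] S.map J.subtype :=
    Submodule.equivMapOfInjective J.subtype J.injective_subtype S
  have hbot : S.map J.subtype = ⊥ :=
    le_bot_iff.1 (hJ (le_sSup ⟨eS.symm.trans e.symm⟩) (Submodule.map_subtype_le J S))
  have := IsSimpleModule.nontrivial B V
  have : Nontrivial (S.map J.subtype) := (e.trans eS).symm.toEquiv.nontrivial
  exact (Submodule.nontrivial_iff_ne_bot.1 this) hbot

theorem exists_smul_eq_self_and_forall_simple_smul_eq_zero [IsSemisimpleRing B] (V : Type u)
    [AddCommGroup V] [Module B V] [IsSimpleModule B V] :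
    ∃ e : B, (∀ v : V, e • v = v) ∧ ∀ (W : Type u) [AddCommGroup W] [Module B W]
      [IsSimpleModule B W], IsEmpty (V ≃ₗ[B] W) → ∀ w : W, e • w = 0 := by
  obtain ⟨J, hJ⟩ := exists_isCompl (isotypicComponent B B V)
  obtain ⟨e, he, f, hf, hef⟩ := Submodule.mem_sup.1
    (hJ.sup_eq_top ▸ Submodule.mem_top : (1 : B) ∈ isotypicComponent B B V ⊔ J)
  refine ⟨e, fun v => ?_, fun W _ _ _ hVW => smul_eq_zero_of_mem_isotypicComponent hVW he⟩
  calc e • v = (e + f) • v := by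
        rw [add_smul, smul_eq_zero_of_disjoint_isotypicComponent hJ.disjoint hf, add_zero]
    _ = v := by rw [hef, one_smul]

end IsotypicComponent

namespace IsSplitSemisimple

variable (h : IsSplitSemisimple K B)
include h

theorem eq_of_forall_simple {a b : B}
    (hab : ∀ (V : Type u) [AddCommGroup V] [Module K V] [Module B V] [IsScalarTower K B V]
      [IsSimpleModule B V], ∀ v : V, a • v = b • v) : a = b := by
  have := h.1
  refine sub_eq_zero.1 (eq_zero_of_forall_simple (K := K) fun V _ _ _ _ _ v => ?_)
  rw [sub_smul, hab, sub_self]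

theorem exists_smul_eq_of_central {z : B} (hz : ∀ b, z * b = b * z)
    (V : Type u) [AddCommGroup V] [Module K V] [Module B V] [IsScalarTower K B V]
    [IsSimpleModule B V] : ∃ c : K, ∀ v : V, z • v = c • v :=
  h.2 V { toFun := fun v => z • v
          map_add' := smul_add z
          map_smul' := fun b v => by simp [← mul_smul, hz] }

theorem eq_block {χ : Module.Dual K B} {e : B} (he : IsBlockOf χ e) : e = block χ := by
  have hb : IsBlockOf χ (block χ) := Classical.epsilon_spec (p := IsBlockOf χ) ⟨e, he⟩
  refine h.eq_of_forall_simple fun V _ _ _ _ _ v => ?_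
  by_cases hV : character K B V = χ
  · rw [(he V).1 hV, (hb V).1 hV]
  · rw [(he V).2 hV, (hb V).2 hV]

variable [Module.Finite K B]

theorem lsmul_surjective (V : Type u) [AddCommGroup V] [Module K V] [Module B V]
    [IsScalarTower K B V] [IsSimpleModule B V] :
    Function.Surjective (Algebra.lsmul K K V : B →ₐ[K] Module.End K V) := by
  intro f
  have := finite_of_isSimpleModule K (B := B) (V := V)
  classical
  let f' : Module.End (Module.End B V) V :=
    { f with
      map_smul' := fun g v => by
        obtain ⟨c, hc⟩ := h.2 V g
        simp [hc] }
  obtain ⟨b, hb⟩ := jacobson_density f' (Finset.univ.image (Module.finBasis K V))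
  refine ⟨b, (Module.finBasis K V).ext fun i => ?_⟩
  exact (hb (Module.finBasis K V i) (Finset.mem_image_of_mem _ (Finset.mem_univ i))).symm

theorem character_ne_zero (V : Type u) [AddCommGroup V] [Module K V] [Module B V]
    [IsScalarTower K B V] [IsSimpleModule B V] : character K B V ≠ 0 := by
  have := finite_of_isSimpleModule K (B := B) (V := V)
  have := IsSimpleModule.nontrivial B V
  obtain ⟨x, hx⟩ := exists_ne (0 : V)
  obtain ⟨φ, hφ⟩ := Module.Projective.exists_dual_ne_zero K hx
  obtain ⟨b, hb⟩ := h.lsmul_surjective V (φ.smulRight x)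
  intro hzero
  apply hφ
  rw [← LinearMap.trace_smulRight, ← hb, ← character_apply, hzero, LinearMap.zero_apply]

theorem nonempty_linearEquiv_of_character_eq (V W : Type u)
    [AddCommGroup V] [Module K V] [Module B V] [IsScalarTower K B V] [IsSimpleModule B V]
    [AddCommGroup W] [Module K W] [Module B W] [IsScalarTower K B W] [IsSimpleModule B W]
    (hVW : character K B V = character K B W) : Nonempty (V ≃ₗ[B] W) := by
  by_contra hne
  have := h.1
  obtain ⟨e, heV, he⟩ := exists_smul_eq_self_and_forall_simple_smul_eq_zero (B := B) V
  refine h.character_ne_zero V (LinearMap.ext fun b => ?_)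
  rw [← character_mul_of_smul_eq_self heV, hVW,
    character_mul_of_smul_eq_zero (he W (not_nonempty_iff.1 hne)), LinearMap.zero_apply]

theorem isBlockOf_block {χ : Module.Dual K B} (hχ : χ ∈ Irr K B) : IsBlockOf χ (block χ) := by
  refine Classical.epsilon_spec (p := IsBlockOf χ) ?_
  obtain ⟨V, _, _, _, _, _, rfl⟩ := hχ
  have := h.1
  obtain ⟨e, heV, he⟩ := exists_smul_eq_self_and_forall_simple_smul_eq_zero (B := B) V
  refine ⟨e, fun W _ _ _ _ _ => ⟨fun hW w => ?_, fun hW => he W ⟨fun f => ?_⟩⟩⟩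
  · obtain ⟨f⟩ := h.nonempty_linearEquiv_of_character_eq W V hW
    apply f.injective
    rw [map_smul, heV]
  · exact hW (character_congr f).symm

section BlockAction

variable {V : Type u} [AddCommGroup V] [Module K V] [Module B V] [IsScalarTower K B V]
  [IsSimpleModule B V]

theorem block_character_smul (v : V) : block (character K B V) • v = v :=
  (h.isBlockOf_block ⟨V, _, _, _, _, ‹_›, rfl⟩ V).1 rfl v

theorem block_smul_of_ne {χ : Module.Dual K B} (hχ : χ ∈ Irr K B) (hV : character K B V ≠ χ)
    (v : V) : block χ • v = 0 :=
  (h.isBlockOf_block hχ V).2 hV v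

theorem sum_block_smul_of_mem {s : Finset (Module.Dual K B)} (hs : ↑s ⊆ Irr K B)
    (hV : character K B V ∈ s) (v : V) : (∑ χ ∈ s, block χ) • v = v := by
  rw [Finset.sum_smul, Finset.sum_eq_single_of_mem _ hV, h.block_character_smul]
  exact fun χ hχ hne => h.block_smul_of_ne (hs hχ) hne.symm v

theorem sum_block_smul_of_notMem {s : Finset (Module.Dual K B)} (hs : ↑s ⊆ Irr K B)
    (hV : character K B V ∉ s) (v : V) : (∑ χ ∈ s, block χ) • v = 0 := by
  rw [Finset.sum_smul]
  exact Finset.sum_eq_zero fun χ hχ => h.block_smul_of_ne (hs hχ) (fun h' => hV (h' ▸ hχ)) v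

end BlockAction

section BlockAlgebra

variable {χ χ' : Module.Dual K B}

theorem block_mul_comm (hχ : χ ∈ Irr K B) (b : B) : block χ * b = b * block χ := by
  refine h.eq_of_forall_simple fun V _ _ _ _ _ v => ?_
  by_cases hV : character K B V = χ
  · subst hV
    rw [mul_smul, mul_smul, h.block_character_smul, h.block_character_smul]
  · rw [mul_smul, mul_smul, h.block_smul_of_ne hχ hV, h.block_smul_of_ne hχ hV, smul_zero]

theorem block_mul_self (hχ : χ ∈ Irr K B) : block χ * block χ = block χ := by
  refine h.eq_of_forall_simple fun V _ _ _ _ _ v => ?_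
  by_cases hV : character K B V = χ
  · subst hV
    rw [mul_smul, h.block_character_smul]
  · rw [mul_smul, h.block_smul_of_ne hχ hV, h.block_smul_of_ne hχ hV]

theorem block_mul_of_ne (hχ : χ ∈ Irr K B) (hχ' : χ' ∈ Irr K B) (hne : χ ≠ χ') :
    block χ * block χ' = 0 := by
  refine h.eq_of_forall_simple fun V _ _ _ _ _ v => ?_
  rw [mul_smul, zero_smul]
  by_cases hV : character K B V = χ
  · rw [h.block_smul_of_ne hχ' (hV ▸ hne), smul_zero]
  · rw [h.block_smul_of_ne hχ hV]

theorem irr_apply_block_mul (hχ : χ ∈ Irr K B) (b : B) : χ (block χ * b) = χ b := by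
  obtain ⟨V, _, _, _, _, _, rfl⟩ := hχ
  exact character_mul_of_smul_eq_self h.block_character_smul b

theorem irr_apply_block_mul_of_ne (hχ : χ ∈ Irr K B) (hχ' : χ' ∈ Irr K B) (hne : χ ≠ χ')
    (b : B) : χ (block χ' * b) = 0 := by
  obtain ⟨V, _, _, _, _, _, rfl⟩ := hχ
  exact character_mul_of_smul_eq_zero (h.block_smul_of_ne hχ' hne) b

theorem irr_ne_zero (hχ : χ ∈ Irr K B) : χ ≠ 0 := by
  obtain ⟨V, _, _, _, _, _, rfl⟩ := hχ
  exact h.character_ne_zero V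

theorem block_ne_zero (hχ : χ ∈ Irr K B) : block χ ≠ 0 := by
  intro hzero
  refine h.irr_ne_zero hχ (LinearMap.ext fun b => ?_)
  rw [← h.irr_apply_block_mul hχ, hzero, zero_mul, map_zero, LinearMap.zero_apply]

theorem block_injOn : Set.InjOn block (Irr K B) := by
  intro χ hχ χ' hχ' heq
  by_contra hne
  apply h.block_ne_zero hχ
  rw [← h.block_mul_self hχ]
  nth_rewrite 2 [heq]
  exact h.block_mul_of_ne hχ hχ' hne

theorem irr_linearIndepOn : LinearIndepOn K id (Irr K B) := by
  rw [linearIndepOn_iff']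
  intro s g hs hsum χ hχ
  obtain ⟨b, hb⟩ : ∃ b, χ b ≠ 0 := DFunLike.ne_iff.1 (h.irr_ne_zero (hs hχ))
  have heval := LinearMap.congr_fun hsum (block χ * b)
  rw [LinearMap.sum_apply, Finset.sum_eq_single_of_mem χ hχ] at heval
  · simpa [h.irr_apply_block_mul (hs hχ), hb] using heval
  · intro χ' hχ' hne
    simp [h.irr_apply_block_mul_of_ne (hs hχ') (hs hχ) hne]

theorem finite_irr : (Irr K B).Finite :=
  LinearIndependent.setFinite h.irr_linearIndepOn

theorem sum_block : ∑ χ ∈ h.finite_irr.toFinset, block χ = 1 := by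
  refine h.eq_of_forall_simple fun V _ _ _ _ _ v => ?_
  rw [one_smul]
  exact h.sum_block_smul_of_mem (by simp) (by simpa using ⟨V, _, _, _, _, ‹_›, rfl⟩) v

end BlockAlgebra

theorem smul_eq_centralValue_smul {z : B} (hz : ∀ b, z * b = b * z) (V : Type u)
    [AddCommGroup V] [Module K V] [Module B V] [IsScalarTower K B V] [IsSimpleModule B V] (v : V) :
    z • v = centralValue (character K B V) z • v := by
  obtain ⟨c, hc⟩ := h.exists_smul_eq_of_central hz V
  refine Classical.epsilon_spec (p := IsCentralValue (character K B V) z) ⟨c, ?_⟩ V rfl v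
  intro W _ _ _ _ _ hW w
  obtain ⟨f⟩ := h.nonempty_linearEquiv_of_character_eq W V hW
  apply f.injective
  rw [map_smul, hc]
  exact ((f.restrictScalars K).map_smul c w).symm

end IsSplitSemisimple

namespace IsSymmetrizingForm

variable {T : B →ₗ[K] K} (hT : IsSymmetrizingForm T)
include hT

theorem apply_dualElement_mul (τ : Module.Dual K B) (b : B) : T (dualElement T τ * b) = τ b :=
  LinearMap.congr_fun (Function.rightInverse_invFun hT.bijective.2 τ) b

theorem ext {x y : B} (hxy : ∀ b, T (x * b) = T (y * b)) : x = y :=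
  hT.bijective.1 (LinearMap.ext hxy)

theorem dualElement_mul_comm {τ : Module.Dual K B} (hτ : ∀ a b, τ (a * b) = τ (b * a)) (b : B) :
    dualElement T τ * b = b * dualElement T τ := by
  refine hT.ext fun x => ?_
  rw [mul_assoc, hT.apply_dualElement_mul, hT.trace, ← mul_assoc, hT.trace,
    hT.apply_dualElement_mul, hτ]

theorem dualElement_mul_block (h : IsSplitSemisimple K B) [Module.Finite K B]
    {χ : Module.Dual K B} (hχ : χ ∈ Irr K B) : dualElement T χ * block χ = dualElement T χ := by
  refine hT.ext fun x => ?_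
  rw [mul_assoc, hT.apply_dualElement_mul, hT.apply_dualElement_mul, h.irr_apply_block_mul hχ]

theorem dualElement_smul_of_ne (h : IsSplitSemisimple K B) [Module.Finite K B]
    {χ : Module.Dual K B} (hχ : χ ∈ Irr K B) {V : Type u} [AddCommGroup V] [Module K V]
    [Module B V] [IsScalarTower K B V] [IsSimpleModule B V] (hV : character K B V ≠ χ) (v : V) :
    dualElement T χ • v = 0 := by
  rw [← hT.dualElement_mul_block h hχ, mul_smul, h.block_smul_of_ne hχ hV, smul_zero]

theorem sum_dualElement_smul (h : IsSplitSemisimple K B) [Module.Finite K B] {V : Type u}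
    [AddCommGroup V] [Module K V] [Module B V] [IsScalarTower K B V] [IsSimpleModule B V]
    {s : Finset (Module.Dual K B)} (hs : ↑s ⊆ Irr K B) (hV : character K B V ∈ s) (v : V) :
    (∑ χ ∈ s, dualElement T χ) • v =
      centralValue (character K B V) (dualElement T (character K B V)) • v := by
  rw [Finset.sum_smul, Finset.sum_eq_single_of_mem _ hV fun χ hχ hne =>
    hT.dualElement_smul_of_ne h (hs hχ) hne.symm v]
  exact h.smul_eq_centralValue_smul (hT.dualElement_mul_comm (mul_comm_of_mem_irr (hs hV))) V v

end IsSymmetrizingForm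

end SplitSemisimple

section Restriction

variable {K : Type v} [Field K] {C B : Type u} [Ring C] [Algebra K C] [Ring B] [Algebra K B]

/-- The restriction of a `B`-module `V` along `φ : C → B`, as a type synonym of `V`. -/
def Res (_φ : C →ₐ[K] B) (V : Type*) : Type _ := V

variable (φ : C →ₐ[K] B) (V : Type*) [AddCommGroup V] [Module K V] [Module B V]

instance : AddCommGroup (Res φ V) := inferInstanceAs (AddCommGroup V)

instance : Module K (Res φ V) := inferInstanceAs (Module K V)

instance : Module C (Res φ V) := Module.compHom V φ.toRingHom

/-- The identity map from `V` to its restriction. -/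
def toRes : V ≃ₗ[K] Res φ V := LinearEquiv.refl K V

variable {φ V}

theorem toRes_symm_smul (c : C) (v : Res φ V) :
    (toRes φ V).symm (c • v) = φ c • (toRes φ V).symm v := rfl

instance [IsScalarTower K B V] : IsScalarTower K C (Res φ V) :=
  ⟨fun k c v => by
    apply (toRes φ V).symm.injective
    rw [toRes_symm_smul, map_smul, map_smul, toRes_symm_smul, smul_assoc]⟩

theorem character_res [IsScalarTower K B V] :
    character K C (Res φ V) = character K B V ∘ₗ φ.toLinearMap := by
  ext c
  rw [LinearMap.comp_apply, character_apply, character_apply,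
    ← LinearMap.trace_conj' _ (toRes φ V)]
  congr 1

theorem isSimpleModule_res [IsSimpleModule B V] (hφ : Function.Surjective φ) :
    IsSimpleModule C (Res φ V) := by
  have : RingHomSurjective φ.toRingHom := ⟨hφ⟩
  let l : Res φ V →ₛₗ[φ.toRingHom] V :=
    { toFun := (toRes φ V).symm
      map_add' := fun _ _ => rfl
      map_smul' := fun _ _ => rfl }
  exact (LinearMap.isSimpleModule_iff_of_bijective l (toRes φ V).symm.bijective).2 inferInstance

theorem comp_mem_irr {χ : Module.Dual K B} (hχ : χ ∈ Irr K B) (hφ : Function.Surjective φ) :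
    χ ∘ₗ φ.toLinearMap ∈ Irr K C := by
  obtain ⟨V, _, _, _, _, _, rfl⟩ := hχ
  exact ⟨Res φ V, inferInstance, inferInstance, inferInstance, inferInstance,
    isSimpleModule_res hφ, character_res⟩

theorem apply_block_comp [Module.Finite K C] (hB : IsSplitSemisimple K B)
    (hC : IsSplitSemisimple K C) {χ : Module.Dual K B} (hχ : χ ∈ Irr K B) (σ : C ≃ₐ[K] B) :
    σ (block (χ ∘ₗ σ.toLinearMap)) = block χ := by
  let φ : C →ₐ[K] B := σ
  have hχσ : χ ∘ₗ σ.toLinearMap ∈ Irr K C := comp_mem_irr (φ := φ) hχ σ.surjective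
  refine hB.eq_block fun V _ _ _ _ _ => ?_
  have : IsSimpleModule C (Res φ V) := isSimpleModule_res σ.surjective
  refine ⟨fun hV v => ?_, fun hV v => ?_⟩
  · refine (hC.isBlockOf_block hχσ (Res φ V)).1 ?_ (toRes φ V v)
    rw [character_res, hV]
    rfl
  · refine hC.block_smul_of_ne hχσ (fun heq => hV ?_) (toRes φ V v)
    rw [character_res] at heq
    exact (LinearMap.cancel_right σ.surjective).1 heq

end Restriction

theorem ncard_orbit_nsmul_sum_smul {H α M : Type*} [Group H] [Fintype H] [MulAction H α]
    [AddCommMonoid M] (f : α → M) (x : α) :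
    (MulAction.orbit H x).ncard • ∑ h : H, f (h • x) =
      Nat.card H • ∑ᶠ y ∈ MulAction.orbit H x, f y := by
  classical
  have : Fintype (MulAction.orbit H x) := (Set.finite_range fun h : H => h • x).fintype
  have hsum := calc ∑ h : H, f (h • x)
      = ∑ p : MulAction.orbit H x × MulAction.stabilizer H x, f p.1 :=
        Fintype.sum_equiv (MulAction.orbitProdStabilizerEquivGroup H x).symm _ _ fun _ => rfl
    _ = ∑ y : MulAction.orbit H x, Nat.card (MulAction.stabilizer H x) • f y := by
        simp [Fintype.sum_prod_type, Nat.card_eq_fintype_card]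
    _ = Nat.card (MulAction.stabilizer H x) • ∑ᶠ y ∈ MulAction.orbit H x, f y := by
        rw [← Finset.smul_sum, ← finsum_eq_sum_of_fintype, finsum_set_coe_eq_finsum_mem]
  rw [hsum, smul_smul, ← MulAction.index_stabilizer, Subgroup.index_mul_card]

section LinearCharacters

variable (G K : Type*) [Group G] [Field K] [HasEnoughRootsOfUnity K (Nat.card G)]

theorem hasEnoughRootsOfUnity_exponent [IsCyclic G] :
    HasEnoughRootsOfUnity K (Monoid.exponent G) := by
  rwa [IsCyclic.exponent_eq_card]

variable [Finite G]

theorem natCast_card_ne_zero : (Nat.card G : K) ≠ 0 := by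
  obtain ⟨ζ, hζ⟩ := HasEnoughRootsOfUnity.exists_primitiveRoot K (Nat.card G)
  have : NeZero (Nat.card G) := ⟨Nat.card_pos.ne'⟩
  exact hζ.neZero'.out

variable [IsCyclic G]

theorem nonempty_linearCharacters_mulEquiv : Nonempty ((G →* Kˣ) ≃* G) := by
  let _ : CommGroup G := IsCyclic.commGroup
  have := hasEnoughRootsOfUnity_exponent G K
  exact CommGroup.monoidHom_mulEquiv_of_hasEnoughRootsOfUnity G K

theorem isCyclic_linearCharacters : IsCyclic (G →* Kˣ) := by
  obtain ⟨e⟩ := nonempty_linearCharacters_mulEquiv G K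
  exact isCyclic_of_surjective e.symm e.symm.surjective

theorem finite_linearCharacters : Finite (G →* Kˣ) := by
  obtain ⟨e⟩ := nonempty_linearCharacters_mulEquiv G K
  exact Finite.of_equiv G e.symm

theorem card_linearCharacters : Nat.card (G →* Kˣ) = Nat.card G := by
  obtain ⟨e⟩ := nonempty_linearCharacters_mulEquiv G K
  exact Nat.card_congr e.toEquiv

variable {G K}

theorem sum_linearCharacters_apply [Fintype (G →* Kˣ)] {g : G} (hg : g ≠ 1) :
    ∑ ξ : G →* Kˣ, (ξ g : K) = 0 := by
  let _ : CommGroup G := IsCyclic.commGroup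
  have := hasEnoughRootsOfUnity_exponent G K
  obtain ⟨η, hη⟩ := CommGroup.exists_apply_ne_one_of_hasEnoughRootsOfUnity G K hg
  refine sum_hom_units_eq_zero ((Units.coeHom K).comp (MonoidHom.eval g)) fun heval => hη ?_
  simpa using DFunLike.congr_fun heval η

end LinearCharacters

section MultiplicityFree

variable {K : Type v} [Field K] {C : Type u} [Ring C] [Algebra K C]
  {M : Type u} [AddCommGroup M] [Module K M] [Module C M] [IsScalarTower K C M]

variable (K C M) in
/-- The irreducible characters that occur in the module `M`. -/
def constituents : Set (Module.Dual K C) :=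
  {ψ | ∃ X : Submodule C M, IsSimpleModule C X ∧ character K C X = ψ}

theorem constituents_subset_irr : constituents K C M ⊆ Irr K C := fun _ ⟨X, hX, hψ⟩ =>
  ⟨X, _, _, _, inferInstance, hX, hψ⟩

theorem nonempty_constituents [IsSemisimpleModule C M] [Nontrivial M] :
    (constituents K C M).Nonempty :=
  let ⟨X, hX⟩ := IsSemisimpleModule.exists_simple_submodule C M
  ⟨_, X, hX, rfl⟩

theorem isFullyInvariant_of_commute [IsSemisimpleModule C M]
    (hcomm : ∀ f g : Module.End C M, Commute f g) (N : Submodule C M) : N.IsFullyInvariant := by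
  intro f x hx
  obtain ⟨N', hN'⟩ := exists_isCompl N
  have hfx : N.projection N' hN' (f x) = f x := by
    simpa [Submodule.projection_apply_of_mem_left hN' hx] using
      (LinearMap.congr_fun (hcomm f (N.projection N' hN')) x).symm
  rw [Submodule.mem_comap, ← hfx]
  exact Submodule.projection_apply_mem hN' (f x)

namespace IsSplitSemisimple

variable [Module.Finite K C] (hC : IsSplitSemisimple K C)
include hC

theorem block_smul_mem_isotypicComponent (X : Type u) [AddCommGroup X] [Module K X] [Module C X]
    [IsScalarTower K C X] [IsSimpleModule C X] (m : M) :
    block (character K C X) • m ∈ isotypicComponent C M X := by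
  have := hC.1
  have hm : m ∈ sSup {N : Submodule C M | IsSimpleModule C N} := by
    rw [IsSemisimpleModule.sSup_simples_eq_top]
    trivial
  rw [sSup_eq_iSup'] at hm
  induction hm using Submodule.iSup_induction' with
  | mem N m hm =>
    have : IsSimpleModule C N.1 := N.2
    by_cases hN : character K C N.1 = character K C X
    · have hle : N.1 ≤ isotypicComponent C M X :=
        le_sSup (hC.nonempty_linearEquiv_of_character_eq N.1 X hN)
      exact hle (N.1.smul_mem _ hm)
    · have hzero : block (character K C X) • (⟨m, hm⟩ : N.1) = 0 :=
        hC.block_smul_of_ne ⟨X, _, _, _, _, ‹_›, rfl⟩ hN _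
      rw [show block (character K C X) • m = 0 from congrArg Subtype.val hzero]
      exact zero_mem _
  | zero => simp
  | add m m' _ _ hm hm' => rw [smul_add]; exact add_mem hm hm'

theorem block_smul_mem_of_commute (hcomm : ∀ f g : Module.End C M, Commute f g)
    (X : Submodule C M) [IsSimpleModule C X] (m : M) : block (character K C X) • m ∈ X := by
  have := hC.1
  exact isFullyInvariant_iff_le_imp_isotypicComponent_le.1 (isFullyInvariant_of_commute hcomm X)
    X le_rfl (hC.block_smul_mem_isotypicComponent X m)

theorem mem_constituents_of_block_smul_ne_zero {ψ : Module.Dual K C} (hψ : ψ ∈ Irr K C) {m : M}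
    (hm : block ψ • m ≠ 0) : ψ ∈ constituents K C M := by
  obtain ⟨X, _, _, _, _, _, rfl⟩ := hψ
  by_contra hX
  suffices isotypicComponent C M X ≤ ⊥ from
    hm (by simpa using this (hC.block_smul_mem_isotypicComponent X m))
  refine sSup_le fun N ⟨e⟩ => (hX ⟨N, IsSimpleModule.congr e, character_congr e⟩).elim

theorem finite_constituents : (constituents K C M).Finite :=
  hC.finite_irr.subset constituents_subset_irr

theorem mem_constituents_iff {ψ : Module.Dual K C} :
    ψ ∈ constituents K C M ↔ ψ ∈ Irr K C ∧ ∃ m : M, block ψ • m ≠ 0 := by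
  refine ⟨fun hψ => ⟨constituents_subset_irr hψ, ?_⟩,
    fun ⟨hψ, m, hm⟩ => hC.mem_constituents_of_block_smul_ne_zero hψ hm⟩
  obtain ⟨X, hX, rfl⟩ := hψ
  have := IsSimpleModule.nontrivial C X
  obtain ⟨x, hx⟩ := exists_ne (0 : X)
  exact ⟨x, fun h => hx ((hC.block_character_smul x).symm.trans (Subtype.ext h))⟩

theorem block_smul_of_notMem_constituents {ψ : Module.Dual K C} (hψ : ψ ∈ Irr K C)
    (hψM : ψ ∉ constituents K C M) (m : M) : block ψ • m = 0 :=
  by_contra fun hm => hψM (hC.mem_constituents_of_block_smul_ne_zero hψ hm)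

theorem sum_block_smul_of_constituents_subset {s : Finset (Module.Dual K C)} (hs : ↑s ⊆ Irr K C)
    (hM : constituents K C M ⊆ s) (m : M) : (∑ ψ ∈ s, block ψ) • m = m := by
  conv_rhs => rw [← one_smul C m, ← hC.sum_block]
  rw [Finset.sum_smul, Finset.sum_smul]
  refine Finset.sum_subset (fun ψ hψ => by simpa using hs hψ) fun ψ hψ hψs => ?_
  exact hC.block_smul_of_notMem_constituents (by simpa using hψ) (fun h => hψs (hM h)) m

theorem character_block_mul_of_notMem_constituents {ψ : Module.Dual K C} (hψ : ψ ∈ Irr K C)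
    (hψM : ψ ∉ constituents K C M) (c : C) : character K C M (block ψ * c) = 0 :=
  character_mul_of_smul_eq_zero (hC.block_smul_of_notMem_constituents hψ hψM) c

theorem character_block_mul_of_commute (hcomm : ∀ f g : Module.End C M, Commute f g)
    {ψ : Module.Dual K C} (hψ : ψ ∈ constituents K C M) [Module.Finite K M] (c : C) :
    character K C M (block ψ * c) = ψ c := by
  obtain ⟨X, hX, rfl⟩ := hψ
  have := finite_of_isSimpleModule K (B := C) (V := X)
  let i : X →ₗ[K] M := (X.restrictScalars K).subtype
  let p : M →ₗ[K] X := (Algebra.lsmul K K M (block (character K C X))).codRestrict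
    (X.restrictScalars K) (hC.block_smul_mem_of_commute hcomm X)
  have hpi : p ∘ₗ (Algebra.lsmul K K M c ∘ₗ i) = Algebra.lsmul K K X c := by
    ext x
    exact congrArg Subtype.val (hC.block_character_smul (c • x))
  have hip : Algebra.lsmul K K M (block (character K C X) * c) =
      i ∘ₗ p ∘ₗ Algebra.lsmul K K M c := by
    ext m
    exact mul_smul (block (character K C X)) c m
  rw [character_apply, hip, LinearMap.trace_comp_comm', LinearMap.comp_assoc, hpi, character_apply]

theorem character_eq_finsum_constituents (hcomm : ∀ f g : Module.End C M, Commute f g)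
    [Module.Finite K M] : character K C M = ∑ᶠ ψ ∈ constituents K C M, ψ := by
  classical
  rw [finsum_mem_eq_finite_toFinset_sum _ hC.finite_constituents]
  ext c
  calc character K C M c
      = ∑ ψ ∈ hC.finite_irr.toFinset, character K C M (block ψ * c) := by
        rw [← map_sum, ← Finset.sum_mul, hC.sum_block, one_mul]
    _ = ∑ ψ ∈ hC.finite_constituents.toFinset, ψ c := by
        symm
        refine Finset.sum_subset_zero_on_sdiff
          (by simpa using constituents_subset_irr) (fun ψ hψ => ?_) fun ψ hψ => ?_
        · simp only [Finset.mem_sdiff, Set.Finite.mem_toFinset] at hψ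
          exact hC.character_block_mul_of_notMem_constituents hψ.1 hψ.2 c
        · exact (hC.character_block_mul_of_commute hcomm (by simpa using hψ) c).symm
    _ = _ := (LinearMap.sum_apply ..).symm

/-- The action of the block `e(ψ)` of a constituent `ψ` on a module, as a `C`-linear map. -/
def blockEnd (ψ : constituents K C M) : Module.End C M :=
  Module.End.smulLeft (block ψ.1)
    (Semigroup.mem_center_iff.2 fun b => (hC.block_mul_comm (constituents_subset_irr ψ.2) b).symm)

theorem blockEnd_apply (ψ : constituents K C M) (m : M) : hC.blockEnd ψ m = block ψ.1 • m := rfl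

theorem blockEnd_mul_self (ψ : constituents K C M) :
    hC.blockEnd ψ * hC.blockEnd ψ = hC.blockEnd ψ := by
  ext m
  rw [Module.End.mul_apply, blockEnd_apply, blockEnd_apply, ← mul_smul,
    hC.block_mul_self (constituents_subset_irr ψ.2)]

theorem blockEnd_mul_of_ne {ψ ψ' : constituents K C M} (hne : ψ ≠ ψ') :
    hC.blockEnd ψ * hC.blockEnd ψ' = 0 := by
  ext m
  rw [Module.End.mul_apply, blockEnd_apply, blockEnd_apply, ← mul_smul,
    hC.block_mul_of_ne (constituents_subset_irr ψ.2) (constituents_subset_irr ψ'.2)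
      (Subtype.coe_injective.ne hne), zero_smul, LinearMap.zero_apply]

theorem blockEnd_ne_zero (ψ : constituents K C M) : hC.blockEnd ψ ≠ 0 := by
  obtain ⟨-, m, hm⟩ := hC.mem_constituents_iff.1 ψ.2
  exact fun hzero => hm (LinearMap.congr_fun hzero m)

theorem linearIndependent_blockEnd : LinearIndependent K (hC.blockEnd (M := M)) := by
  rw [linearIndependent_iff']
  intro s a ha ψ hψ
  have hmul : (∑ ψ' ∈ s, a ψ' • hC.blockEnd ψ') * hC.blockEnd ψ = a ψ • hC.blockEnd ψ := by
    rw [Finset.sum_mul, Finset.sum_eq_single_of_mem ψ hψ, smul_mul_assoc, hC.blockEnd_mul_self]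
    intro ψ' _ hne
    rw [smul_mul_assoc, hC.blockEnd_mul_of_ne hne, smul_zero]
  rw [ha, zero_mul] at hmul
  exact (smul_eq_zero.1 hmul.symm).resolve_right (hC.blockEnd_ne_zero ψ)

theorem sum_blockEnd [Fintype (constituents K C M)] :
    ∑ ψ : constituents K C M, hC.blockEnd ψ = 1 := by
  ext m
  calc (∑ ψ : constituents K C M, hC.blockEnd ψ) m
      = ∑ ψ : constituents K C M, block ψ.1 • m := LinearMap.sum_apply ..
    _ = ∑ ψ ∈ (hC.finite_constituents (M := M)).toFinset, block ψ • m :=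
        (Finset.sum_subtype _ (by simp) fun ψ => block ψ • m).symm
    _ = m := by
        rw [← Finset.sum_smul]
        exact hC.sum_block_smul_of_constituents_subset (by simpa using constituents_subset_irr)
          (by simp) m

theorem exists_mul_blockEnd_eq_smul (hcomm : ∀ f g : Module.End C M, Commute f g)
    (f : Module.End C M) (ψ : constituents K C M) :
    ∃ c : K, f * hC.blockEnd ψ = c • hC.blockEnd ψ := by
  obtain ⟨_, X, hX, rfl⟩ := ψ
  have := hC.1
  have hf : ∀ x ∈ X, f x ∈ X := isFullyInvariant_of_commute hcomm X f
  obtain ⟨c, hc⟩ := hC.2 X (f.restrict hf)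
  refine ⟨c, LinearMap.ext fun m => ?_⟩
  exact congrArg Subtype.val (hc ⟨_, hC.block_smul_mem_of_commute hcomm X m⟩)

theorem finrank_end_eq_ncard_constituents (hcomm : ∀ f g : Module.End C M, Commute f g) :
    Module.finrank K (Module.End C M) = (constituents K C M).ncard := by
  have := hC.finite_constituents (M := M).fintype
  have hspan : ⊤ ≤ Submodule.span K (Set.range (hC.blockEnd (M := M))) := by
    intro f _
    choose c hc using hC.exists_mul_blockEnd_eq_smul hcomm f
    rw [← mul_one f, ← hC.sum_blockEnd, Finset.mul_sum]
    simp only [hc]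
    exact Submodule.sum_mem _ fun ψ _ => Submodule.smul_mem _ _ (Submodule.subset_span ⟨ψ, rfl⟩)
  rw [Module.finrank_eq_card_basis (Module.Basis.mk hC.linearIndependent_blockEnd hspan),
    ← Nat.card_eq_fintype_card, Nat.card_coe_set_eq]

end IsSplitSemisimple

end MultiplicityFree

section CrossedProduct

variable {K : Type v} [Field K] {C B : Type u} [Ring C] [Algebra K C] [Ring B] [Algebra K B]
  {G : Type*} [Group G] [DecidableEq G]

/-- `B` is a crossed product of `C` and `G`: it is graded by `G`, with component `ι(C)` in degree
`1` and a unit in every degree `g`. This is what remains of a twisted symmetric algebra after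
extension of scalars to `K`, apart from the symmetrizing form. -/
structure IsCrossedProduct (ι : C →ₐ[K] B) (𝓑 : G → Submodule K B) : Prop where
  injective : Function.Injective ι
  isInternal : DirectSum.IsInternal 𝓑
  mem_one : ∀ b, b ∈ 𝓑 1 ↔ ∃ c, ι c = b
  mul_mem : ∀ {g h : G} {a b : B}, a ∈ 𝓑 g → b ∈ 𝓑 h → a * b ∈ 𝓑 (g * h)
  exists_unit : ∀ g, ∃ w : Bˣ, (w : B) ∈ 𝓑 g

namespace IsCrossedProduct

variable {ι : C →ₐ[K] B} {𝓑 : G → Submodule K B} (hd : IsCrossedProduct ι 𝓑)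
include hd

/-- A chosen homogeneous unit of degree `g`. -/
def unit (g : G) : Bˣ := (hd.exists_unit g).choose

theorem unit_mem (g : G) : (hd.unit g : B) ∈ 𝓑 g := (hd.exists_unit g).choose_spec

theorem ι_mem (c : C) : ι c ∈ 𝓑 1 := (hd.mem_one _).2 ⟨c, rfl⟩

theorem one_mem : (1 : B) ∈ 𝓑 1 := map_one ι ▸ hd.ι_mem 1

/-- The projection of `B` onto its homogeneous component of degree `g`. -/
def proj (g : G) : B →ₗ[K] B :=
  let _ := hd.isInternal.chooseDecomposition
  (𝓑 g).subtype ∘ₗ DirectSum.component K G (fun h => 𝓑 h) g ∘ₗ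
    (DirectSum.decomposeLinearEquiv 𝓑).toLinearMap

theorem proj_mem (g : G) (b : B) : hd.proj g b ∈ 𝓑 g := Subtype.prop _

theorem proj_of_mem {g : G} {b : B} (hb : b ∈ 𝓑 g) : hd.proj g b = b :=
  let _ := hd.isInternal.chooseDecomposition
  DirectSum.decompose_of_mem_same 𝓑 hb

theorem proj_of_ne {g h : G} {b : B} (hb : b ∈ 𝓑 h) (hne : g ≠ h) : hd.proj g b = 0 :=
  let _ := hd.isInternal.chooseDecomposition
  DirectSum.decompose_of_mem_ne 𝓑 hb hne.symm

theorem induction_on {p : B → Prop} (hmem : ∀ g, ∀ b ∈ 𝓑 g, p b)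
    (hadd : ∀ a b, p a → p b → p (a + b)) (b : B) : p b := by
  have hb : b ∈ iSup 𝓑 := hd.isInternal.submodule_iSup_eq_top ▸ Submodule.mem_top
  exact Submodule.iSup_induction 𝓑 (motive := p) hb hmem (hmem 1 0 (zero_mem _)) hadd

theorem proj_mul_of_mem_left {g : G} {a : B} (ha : a ∈ 𝓑 g) (h : G) (b : B) :
    hd.proj (g * h) (a * b) = a * hd.proj h b := by
  induction b using hd.induction_on with
  | hmem k b hb =>
    rcases eq_or_ne h k with rfl | hne
    · rw [hd.proj_of_mem hb, hd.proj_of_mem (hd.mul_mem ha hb)]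
    · rw [hd.proj_of_ne hb hne, mul_zero,
        hd.proj_of_ne (hd.mul_mem ha hb) ((mul_right_injective g).ne hne)]
  | hadd b b' hb hb' => rw [mul_add, map_add, map_add, mul_add, hb, hb']

theorem proj_mul_of_mem_right {h : G} {b : B} (hb : b ∈ 𝓑 h) (g : G) (a : B) :
    hd.proj (g * h) (a * b) = hd.proj g a * b := by
  induction a using hd.induction_on with
  | hmem k a ha =>
    rcases eq_or_ne g k with rfl | hne
    · rw [hd.proj_of_mem ha, hd.proj_of_mem (hd.mul_mem ha hb)]
    · rw [hd.proj_of_ne ha hne, zero_mul,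
        hd.proj_of_ne (hd.mul_mem ha hb) ((mul_left_injective h).ne hne)]
  | hadd a a' ha ha' => rw [add_mul, map_add, map_add, add_mul, ha, ha']

theorem proj_ι_mul (c : C) (b : B) : hd.proj 1 (ι c * b) = ι c * hd.proj 1 b := by
  simpa using hd.proj_mul_of_mem_left (hd.ι_mem c) 1 b

theorem inv_mem {g : G} {w : Bˣ} (hw : (w : B) ∈ 𝓑 g) : (↑w⁻¹ : B) ∈ 𝓑 g⁻¹ := by
  have hproj : w * hd.proj g⁻¹ (↑w⁻¹ : B) = 1 := by
    rw [← hd.proj_mul_of_mem_left hw, mul_inv_cancel, Units.mul_inv, hd.proj_of_mem hd.one_mem]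
  rw [Units.inv_eq_of_mul_eq_one_right hproj]
  exact hd.proj_mem _ _

theorem exists_ι_eq_inv_mul {g : G} {w : Bˣ} (hw : (w : B) ∈ 𝓑 g) {b : B} (hb : b ∈ 𝓑 g) :
    ∃ c, ι c = ↑w⁻¹ * b :=
  (hd.mem_one _).1 (inv_mul_cancel g ▸ hd.mul_mem (hd.inv_mem hw) hb)

section Twist

/-- The `K`-linear map that multiplies the component of degree `g` by `ξ g`. -/
def twistLinearMap (ξ : G →* Kˣ) : B →ₗ[K] B :=
  let _ := hd.isInternal.chooseDecomposition
  DirectSum.toModule K G B (fun g => (ξ g : K) • (𝓑 g).subtype) ∘ₗ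
    (DirectSum.decomposeLinearEquiv 𝓑).toLinearMap

theorem twistLinearMap_of_mem (ξ : G →* Kˣ) {g : G} {b : B} (hb : b ∈ 𝓑 g) :
    hd.twistLinearMap ξ b = (ξ g : K) • b := by
  let _ := hd.isInternal.chooseDecomposition
  rw [twistLinearMap, LinearMap.comp_apply, LinearEquiv.coe_coe,
    DirectSum.decomposeLinearEquiv_apply, DirectSum.decompose_of_mem 𝓑 hb]
  exact DirectSum.toModule_lof K g _

/-- The automorphism of `B` through which the linear character `ξ` acts on the characters of
`B`: it multiplies the component of degree `g` by `ξ g`. -/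
def twist (ξ : G →* Kˣ) : B →ₐ[K] B :=
  AlgHom.ofLinearMap (hd.twistLinearMap ξ)
    (by rw [hd.twistLinearMap_of_mem ξ hd.one_mem, map_one, Units.val_one, one_smul])
    (fun a b => by
      induction a using hd.induction_on with
      | hmem g a ha =>
        induction b using hd.induction_on with
        | hmem h b hb =>
          rw [hd.twistLinearMap_of_mem ξ ha, hd.twistLinearMap_of_mem ξ hb,
            hd.twistLinearMap_of_mem ξ (hd.mul_mem ha hb), map_mul, smul_mul_smul_comm,
            Units.val_mul]
        | hadd b b' hb hb' => rw [mul_add, map_add, map_add, mul_add, hb, hb']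
      | hadd a a' ha ha' => rw [add_mul, map_add, map_add, add_mul, ha, ha'])

theorem twist_of_mem (ξ : G →* Kˣ) {g : G} {b : B} (hb : b ∈ 𝓑 g) :
    hd.twist ξ b = (ξ g : K) • b :=
  hd.twistLinearMap_of_mem ξ hb

theorem twist_mul (ξ η : G →* Kˣ) : hd.twist (ξ * η) = (hd.twist η).comp (hd.twist ξ) := by
  ext b
  induction b using hd.induction_on with
  | hmem g b hb =>
    rw [AlgHom.comp_apply, hd.twist_of_mem ξ hb, map_smul, hd.twist_of_mem η hb,
      hd.twist_of_mem _ hb, smul_smul, MonoidHom.mul_apply, Units.val_mul]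
  | hadd b b' hb hb' => rw [map_add, map_add, hb, hb']

theorem twist_one : hd.twist 1 = AlgHom.id K B := by
  ext b
  induction b using hd.induction_on with
  | hmem g b hb => simp [hd.twist_of_mem _ hb]
  | hadd b b' hb hb' => rw [map_add, map_add, hb, hb']

theorem twist_surjective (ξ : G →* Kˣ) : Function.Surjective (hd.twist ξ) := by
  have hinv : ξ⁻¹ * ξ = 1 := inv_mul_cancel ξ
  intro b
  exact ⟨hd.twist ξ⁻¹ b, by rw [← AlgHom.comp_apply, ← hd.twist_mul, hinv, hd.twist_one]; rfl⟩

theorem twist_ι (ξ : G →* Kˣ) (c : C) : hd.twist ξ (ι c) = ι c := by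
  rw [hd.twist_of_mem ξ (hd.ι_mem c), map_one, Units.val_one, one_smul]

theorem sum_twist [Finite G] [IsCyclic G] [HasEnoughRootsOfUnity K (Nat.card G)]
    [Fintype (G →* Kˣ)] (b : B) : ∑ ξ, hd.twist ξ b = (Nat.card G : K) • hd.proj 1 b := by
  induction b using hd.induction_on with
  | hmem g b hb =>
    simp only [hd.twist_of_mem _ hb]
    rw [← Finset.sum_smul]
    rcases eq_or_ne g 1 with rfl | hg
    · rw [hd.proj_of_mem hb, ← card_linearCharacters G K]
      simp
    · rw [sum_linearCharacters_apply hg, hd.proj_of_ne hb hg.symm, zero_smul, smul_zero]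
  | hadd b b' hb hb' =>
    simp only [map_add]
    rw [Finset.sum_add_distrib, hb, hb', smul_add]

/-- The action `(ξ, χ) ↦ χ ∘ twist ξ` of the linear characters of `G` on the linear forms on `B`. -/
@[reducible] def twistAction : MulAction (G →* Kˣ) (Module.Dual K B) where
  smul ξ χ := χ ∘ₗ (hd.twist ξ).toLinearMap
  one_smul χ := LinearMap.ext fun b => congrArg χ (DFunLike.congr_fun hd.twist_one b)
  mul_smul ξ η χ := LinearMap.ext fun b => congrArg χ (DFunLike.congr_fun (hd.twist_mul ξ η) b)

/-- The orbit `{χ · ξ | ξ ∈ G^∨}`. -/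
def twistOrbit (χ : Module.Dual K B) : Set (Module.Dual K B) :=
  Set.range fun ξ => χ ∘ₗ (hd.twist ξ).toLinearMap

/-- The group of linear characters `ξ` with `χ · ξ = χ`. -/
def twistStabilizer (χ : Module.Dual K B) : Subgroup (G →* Kˣ) :=
  let _ := hd.twistAction
  MulAction.stabilizer (G →* Kˣ) χ

theorem mem_twistStabilizer {χ : Module.Dual K B} {ξ : G →* Kˣ} :
    ξ ∈ hd.twistStabilizer χ ↔ χ ∘ₗ (hd.twist ξ).toLinearMap = χ := Iff.rfl

theorem twistOrbit_eq_of_mem {χ χ' : Module.Dual K B} (hχ' : χ' ∈ hd.twistOrbit χ) :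
    hd.twistOrbit χ' = hd.twistOrbit χ :=
  let _ := hd.twistAction
  (MulAction.orbit_eq_iff (G := G →* Kˣ)).2 hχ'

theorem self_mem_twistOrbit (χ : Module.Dual K B) : χ ∈ hd.twistOrbit χ :=
  let _ := hd.twistAction
  MulAction.mem_orbit_self (M := G →* Kˣ) χ

theorem twistOrbit_subset_irr {χ : Module.Dual K B} (hχ : χ ∈ Irr K B) :
    hd.twistOrbit χ ⊆ Irr K B := by
  rintro _ ⟨ξ, rfl⟩
  exact comp_mem_irr hχ (hd.twist_surjective ξ)

variable [Finite G] [IsCyclic G] [HasEnoughRootsOfUnity K (Nat.card G)]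

theorem card_twistStabilizer_mul_ncard_twistOrbit (χ : Module.Dual K B) :
    Nat.card (hd.twistStabilizer χ) * (hd.twistOrbit χ).ncard = Nat.card G := by
  let _ := hd.twistAction
  rw [← card_linearCharacters G K, ← (hd.twistStabilizer χ).card_mul_index]
  exact congrArg _ (MulAction.index_stabilizer (G →* Kˣ) χ).symm

theorem finsum_twistOrbit_apply (χ : Module.Dual K B) (b : B) :
    (∑ᶠ χ' ∈ hd.twistOrbit χ, χ') b = ((hd.twistOrbit χ).ncard : K) * χ (hd.proj 1 b) := by
  have := finite_linearCharacters G K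
  have := Fintype.ofFinite (G →* Kˣ)
  let _ := hd.twistAction
  apply mul_left_cancel₀ (natCast_card_ne_zero G K)
  have hsum : ∑ ξ, χ (hd.twist ξ b) = (Nat.card G : K) * χ (hd.proj 1 b) := by
    rw [← map_sum, hd.sum_twist, map_smul, smul_eq_mul]
  have horbit := LinearMap.congr_fun
    (ncard_orbit_nsmul_sum_smul (H := G →* Kˣ) (fun χ' => χ') χ) b
  rw [card_linearCharacters G K, LinearMap.smul_apply, LinearMap.smul_apply, LinearMap.sum_apply,
    nsmul_eq_mul, nsmul_eq_mul] at horbit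
  rw [mul_left_comm, ← hsum]
  exact horbit.symm

end Twist

section Conj

/-- Conjugation by a homogeneous unit, as an endomorphism of `C`. -/
def conjHom {g : G} {w : Bˣ} (hw : (w : B) ∈ 𝓑 g) : C →ₐ[K] C :=
  (AlgEquiv.ofInjective ι hd.injective).symm.toAlgHom.comp <|
    ((MulSemiringAction.toAlgHom K B (ConjAct.toConjAct w)).comp ι).codRestrict ι.range fun c =>
      (hd.mem_one _).1 <| by
        have := hd.mul_mem (hd.mul_mem hw (hd.ι_mem c)) (hd.inv_mem hw)
        rwa [mul_one, mul_inv_cancel] at this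

theorem ι_conjHom {g : G} {w : Bˣ} (hw : (w : B) ∈ 𝓑 g) (c : C) :
    ι (hd.conjHom hw c) = w * ι c * ↑w⁻¹ :=
  congrArg Subtype.val ((AlgEquiv.ofInjective ι hd.injective).apply_symm_apply _)

/-- The automorphism of `C` through which `g` acts on the characters of `C`: conjugation by the
inverse of a homogeneous unit of degree `g`. It depends on the unit, but its effect on characters
does not. -/
def conj (g : G) : C ≃ₐ[K] C :=
  AlgEquiv.ofAlgHom (hd.conjHom (hd.inv_mem (hd.unit_mem g))) (hd.conjHom (hd.unit_mem g))
    (AlgHom.ext fun c => hd.injective (by simp [ι_conjHom, mul_assoc]))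
    (AlgHom.ext fun c => hd.injective (by simp [ι_conjHom, mul_assoc]))

theorem ι_conj (g : G) (c : C) : ι (hd.conj g c) = ↑(hd.unit g)⁻¹ * ι c * hd.unit g :=
  (hd.ι_conjHom (hd.inv_mem (hd.unit_mem g)) c).trans (by rw [inv_inv])

theorem irr_conj_apply {ψ : Module.Dual K C} (hψ : ψ ∈ Irr K C) {g : G} {w : Bˣ}
    (hw : (w : B) ∈ 𝓑 g) {c c' : C} (hc : ι c' = w * ι c * ↑w⁻¹) : ψ (hd.conj g c') = ψ c := by
  obtain ⟨s, hs⟩ := hd.exists_ι_eq_inv_mul (hd.unit_mem g) hw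
  obtain ⟨s', hs'⟩ := hd.exists_ι_eq_inv_mul hw (hd.unit_mem g)
  have hconj : hd.conj g c' = s * c * s' := hd.injective (by
    simp only [hd.ι_conj, hc, map_mul, hs, hs', mul_assoc])
  have hinv : s' * s = 1 := hd.injective (by simp [hs, hs', mul_assoc])
  rw [hconj, mul_comm_of_mem_irr hψ, ← mul_assoc, hinv, one_mul]

/-- The action of `G` on the irreducible characters of `C` by conjugation. -/
@[reducible] def conjAction : MulAction G (Irr K C) where
  smul g ψ := ⟨ψ.1 ∘ₗ (hd.conj g).toLinearMap, comp_mem_irr (φ := (hd.conj g : C →ₐ[K] C)) ψ.2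
    (hd.conj g).surjective⟩
  one_smul ψ := Subtype.ext (LinearMap.ext fun c =>
    hd.irr_conj_apply ψ.2 (w := 1) hd.one_mem (by simp))
  mul_smul g h ψ := Subtype.ext (LinearMap.ext fun c =>
    hd.irr_conj_apply ψ.2 (w := hd.unit g * hd.unit h)
      (hd.mul_mem (hd.unit_mem g) (hd.unit_mem h)) (by simp [ι_conj, mul_assoc]))

/-- The orbit of `ψ` under conjugation by the homogeneous units of `B`. -/
def conjOrbit (ψ : Module.Dual K C) : Set (Module.Dual K C) :=
  Set.range fun g => ψ ∘ₗ (hd.conj g).toLinearMap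

theorem conjOrbit_eq_image_orbit (ψ : Irr K C) :
    let _ := hd.conjAction
    hd.conjOrbit ψ = Subtype.val '' MulAction.orbit G ψ :=
  let _ := hd.conjAction
  Set.range_comp Subtype.val fun g : G => g • ψ

theorem conjOrbit_subset_irr {ψ : Module.Dual K C} (hψ : ψ ∈ Irr K C) :
    hd.conjOrbit ψ ⊆ Irr K C := by
  rintro _ ⟨g, rfl⟩
  exact comp_mem_irr (φ := (hd.conj g : C →ₐ[K] C)) hψ (hd.conj g).surjective

theorem conjOrbit_eq_of_mem {ψ ψ' : Module.Dual K C} (hψ : ψ ∈ Irr K C)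
    (hψ' : ψ' ∈ hd.conjOrbit ψ) : hd.conjOrbit ψ' = hd.conjOrbit ψ := by
  let _ := hd.conjAction
  rw [hd.conjOrbit_eq_image_orbit ⟨ψ, hψ⟩] at hψ' ⊢
  obtain ⟨ψ', hmem, rfl⟩ := hψ'
  rw [hd.conjOrbit_eq_image_orbit, MulAction.orbit_eq_iff.2 hmem]

theorem ncard_conjOrbit_nsmul_sum [Fintype G] {ψ : Module.Dual K C} (hψ : ψ ∈ Irr K C) :
    (hd.conjOrbit ψ).ncard • ∑ g, ψ ∘ₗ (hd.conj g).toLinearMap =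
      Nat.card G • ∑ᶠ ψ' ∈ hd.conjOrbit ψ, ψ' := by
  let _ := hd.conjAction
  rw [hd.conjOrbit_eq_image_orbit ⟨ψ, hψ⟩, Set.ncard_image_of_injective _ Subtype.val_injective,
    finsum_mem_image Subtype.val_injective.injOn]
  exact ncard_orbit_nsmul_sum_smul (H := G) Subtype.val (⟨ψ, hψ⟩ : Irr K C)

variable [Module.Finite K C] (hC : IsSplitSemisimple K C)
include hC

theorem ι_block_mul_of_mem {ψ : Module.Dual K C} (hψ : ψ ∈ Irr K C) {g : G} {b : B}
    (hb : b ∈ 𝓑 g) :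
    ι (block (ψ ∘ₗ (hd.conj g).toLinearMap)) * b = b * ι (block ψ) := by
  obtain ⟨c, hc⟩ := hd.exists_ι_eq_inv_mul (hd.unit_mem g) hb
  have hblock : ι (block (ψ ∘ₗ (hd.conj g).toLinearMap)) * hd.unit g =
      hd.unit g * ι (block ψ) := by
    rw [← apply_block_comp hC hC hψ (hd.conj g), hd.ι_conj]
    simp [← mul_assoc]
  rw [← (hd.unit g).mul_inv_cancel_left b, ← hc, ← mul_assoc, hblock, mul_assoc, mul_assoc,
    ← map_mul, ← map_mul, hC.block_mul_comm hψ]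

theorem mem_conjOrbit_iff {ψ ψ' : Module.Dual K C} (hψ : ψ ∈ Irr K C) :
    ψ' ∈ hd.conjOrbit ψ ↔
      ψ' ∈ Irr K C ∧ ∃ g, ∀ b ∈ 𝓑 g, ι (block ψ') * b = b * ι (block ψ) := by
  constructor
  · intro hmem
    refine ⟨hd.conjOrbit_subset_irr hψ hmem, ?_⟩
    obtain ⟨g, rfl⟩ := hmem
    exact ⟨g, fun b hb => hd.ι_block_mul_of_mem hC hψ hb⟩
  · rintro ⟨hψ', g, hg⟩
    refine ⟨g, hC.block_injOn (hd.conjOrbit_subset_irr hψ ⟨g, rfl⟩) hψ' (hd.injective ?_)⟩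
    rw [← (hd.unit g).mul_left_inj, hd.ι_block_mul_of_mem hC hψ (hd.unit_mem g),
      hg _ (hd.unit_mem g)]

end Conj

end IsCrossedProduct

end CrossedProduct

section RestrictedHom

variable {K : Type v} [Field K] {C B : Type u} [Ring C] [Algebra K C] [Ring B] [Algebra K B]
  (ι : C →ₐ[K] B) (V W : Type*) [AddCommGroup V] [Module K V] [Module B V]
  [AddCommGroup W] [Module K W] [Module B W] [IsScalarTower K B W]

/-- The `C`-linear maps between the restrictions of two `B`-modules along `ι : C → B`, as
`K`-linear maps between the modules themselves. -/
def homOver : Submodule K (V →ₗ[K] W) where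
  carrier := {f | ∀ (c : C) (v : V), f (ι c • v) = ι c • f v}
  add_mem' hf hf' c v := by rw [LinearMap.add_apply, hf, hf', LinearMap.add_apply, smul_add]
  zero_mem' c _ := (smul_zero (ι c)).symm
  smul_mem' k f hf c v := by rw [LinearMap.smul_apply, hf, LinearMap.smul_apply, smul_comm]

variable [IsScalarTower K B V]

/-- `homOver ι V W` is the space of `C`-linear maps between the restrictions. -/
def homOverEquiv : (Res ι V →ₗ[C] Res ι W) ≃ₗ[K] homOver ι V W where
  toFun f := ⟨(toRes ι W).symm.toLinearMap ∘ₗ f.restrictScalars K ∘ₗ (toRes ι V).toLinearMap,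
    fun c v => f.map_smul c (toRes ι V v)⟩
  invFun f :=
    { toFun v := toRes ι W (f.1 ((toRes ι V).symm v))
      map_add' := f.1.map_add
      map_smul' := f.2 }
  map_add' _ _ := rfl
  map_smul' _ _ := rfl

end RestrictedHom

section TwistedHom

variable {K : Type v} [Field K] {C B : Type u} [Ring C] [Algebra K C] [Ring B] [Algebra K B]
  {G : Type*} [Group G] [DecidableEq G] {ι : C →ₐ[K] B} {𝓑 : G → Submodule K B}
  {V W : Type u} [AddCommGroup V] [Module K V] [Module B V] [AddCommGroup W] [Module K W]
  [Module B W] {hd : IsCrossedProduct ι 𝓑} {ξ η : G →* Kˣ}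

/-- `f` is a homomorphism of `B`-modules from the twist of `V` by the linear character `ξ`
to `W`. -/
def IsTwistedHom (hd : IsCrossedProduct ι 𝓑) (ξ : G →* Kˣ) (f : V →ₗ[K] W) : Prop :=
  ∀ (b : B) (v : V), f (hd.twist ξ b • v) = b • f v

/-- A twisted homomorphism as a homomorphism of `B`-modules. -/
def IsTwistedHom.toHom {f : V →ₗ[K] W} (hf : IsTwistedHom hd ξ f) :
    Res (hd.twist ξ) V →ₗ[B] W where
  toFun v := f ((toRes (hd.twist ξ) V).symm v)
  map_add' := f.map_add
  map_smul' b v := hf b v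

theorem IsTwistedHom.mul {f f' : Module.End K V} (hf : IsTwistedHom hd ξ f)
    (hf' : IsTwistedHom hd η f') : IsTwistedHom hd (ξ * η) (f * f') := fun b v => by
  rw [Module.End.mul_apply, hd.twist_mul, AlgHom.comp_apply, hf', hf, Module.End.mul_apply]

theorem IsTwistedHom.pow {f : Module.End K V} (hf : IsTwistedHom hd ξ f) (k : ℕ) :
    IsTwistedHom hd (ξ ^ k) (f ^ k) := by
  induction k with
  | zero =>
    have hone : ξ ^ 0 = 1 := pow_zero ξ
    intro b v
    rw [hone, hd.twist_one, pow_zero, AlgHom.id_apply, Module.End.one_apply, Module.End.one_apply]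
  | succ k ih =>
    have hsucc : ξ ^ (k + 1) = ξ ^ k * ξ := pow_succ ξ k
    rw [hsucc, pow_succ]
    exact ih.mul hf

theorem IsTwistedHom.bijective [IsSimpleModule B V] [IsSimpleModule B W]
    {f : V →ₗ[K] W} (hf : IsTwistedHom hd ξ f) (hne : f ≠ 0) : Function.Bijective f := by
  have := isSimpleModule_res (V := V) (hd.twist_surjective ξ)
  exact LinearMap.bijective_of_ne_zero (f := hf.toHom) fun h =>
    hne (LinearMap.ext fun v => LinearMap.congr_fun h (toRes (hd.twist ξ) V v))

variable [IsScalarTower K B W]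

theorem IsTwistedHom.exists_eq_smul (hB : IsSplitSemisimple K B) [IsSimpleModule B V]
    [IsSimpleModule B W] {f f' : V →ₗ[K] W} (hf : IsTwistedHom hd ξ f)
    (hf' : IsTwistedHom hd ξ f') (hne : f ≠ 0) : ∃ c : K, f' = c • f := by
  let e := LinearEquiv.ofBijective hf.toHom (hf.bijective hne)
  obtain ⟨c, hc⟩ := hB.2 W (hf'.toHom ∘ₗ e.symm.toLinearMap)
  refine ⟨c, LinearMap.ext fun v => ?_⟩
  have hv := hc (f v)
  rwa [LinearMap.comp_apply, LinearEquiv.coe_coe,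
    show e.symm (f v) = toRes (hd.twist ξ) V v from e.symm_apply_apply _] at hv

theorem IsTwistedHom.mem_homOver {f : V →ₗ[K] W} (hf : IsTwistedHom hd ξ f) :
    f ∈ homOver ι V W := fun c v => by
  rw [← hf, hd.twist_ι]

variable [IsScalarTower K B V]

section ConjMap

/-- The action `f ↦ w ∘ f ∘ w⁻¹` of the units of `B` on linear maps between `B`-modules. -/
def conjMap (w : Bˣ) : Module.End K (V →ₗ[K] W) where
  toFun f := Algebra.lsmul K K W (w : B) ∘ₗ f ∘ₗ Algebra.lsmul K K V (↑w⁻¹ : B)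
  map_add' _ _ := LinearMap.ext fun _ => smul_add _ _ _
  map_smul' _ _ := LinearMap.ext fun _ => smul_comm _ _ _

theorem conjMap_apply (w : Bˣ) (f : V →ₗ[K] W) (v : V) :
    conjMap w f v = (w : B) • f ((↑w⁻¹ : B) • v) := rfl

theorem conjMap_one (f : V →ₗ[K] W) : conjMap (1 : Bˣ) f = f := by
  ext v
  rw [conjMap_apply, inv_one, Units.val_one, one_smul, one_smul]

theorem conjMap_mul (w z : Bˣ) (f : V →ₗ[K] W) :
    conjMap (w * z) f = conjMap w (conjMap z f) := by
  ext v
  simp only [conjMap_apply, mul_inv_rev, Units.val_mul, mul_smul]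

theorem IsTwistedHom.conjMap_eq_smul {f : V →ₗ[K] W} (hf : IsTwistedHom hd ξ f) {g : G} {w : Bˣ}
    (hw : (w : B) ∈ 𝓑 g) : conjMap w f = (ξ g : K) • f := by
  ext v
  rw [conjMap_apply, ← hf, hd.twist_of_mem ξ hw, smul_assoc, ← mul_smul, Units.mul_inv, one_smul,
    map_smul, LinearMap.smul_apply]

theorem IsTwistedHom.of_conjMap_eq_smul {f : V →ₗ[K] W} (hf : f ∈ homOver ι V W)
    (hconj : ∀ g, conjMap (hd.unit g) f = (ξ g : K) • f) : IsTwistedHom hd ξ f := fun b v => by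
  induction b using hd.induction_on with
  | hmem g b hb =>
    obtain ⟨c, hc⟩ := hd.exists_ι_eq_inv_mul (hd.unit_mem g) hb
    have hbc : b = hd.unit g * ι c := by rw [hc, Units.mul_inv_cancel_left]
    have hunit := LinearMap.congr_fun (hconj g) (b • v)
    rw [conjMap_apply, ← mul_smul, ← hc, hf, ← mul_smul, ← hbc] at hunit
    rw [hd.twist_of_mem ξ hb, smul_assoc, map_smul]
    exact hunit.symm
  | hadd b b' hb hb' => rw [map_add, add_smul, map_add, hb, hb', add_smul]

theorem conjMap_unit_mem_homOver (hd : IsCrossedProduct ι 𝓑) {f : V →ₗ[K] W}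
    (hf : f ∈ homOver ι V W) (g : G) : conjMap (hd.unit g) f ∈ homOver ι V W := fun c v => by
  have hc : (↑(hd.unit g)⁻¹ : B) * ι c = ι (hd.conj g c) * ↑(hd.unit g)⁻¹ := by
    rw [hd.ι_conj, Units.mul_inv_cancel_right]
  rw [conjMap_apply, ← mul_smul, hc, mul_smul, hf, ← mul_smul, hd.ι_conj, conjMap_apply,
    ← mul_smul, mul_assoc, Units.mul_inv_cancel_left]

theorem conjMap_eq_of_mem (hd : IsCrossedProduct ι 𝓑) {f : V →ₗ[K] W} (hf : f ∈ homOver ι V W)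
    {g : G} {w z : Bˣ} (hw : (w : B) ∈ 𝓑 g) (hz : (z : B) ∈ 𝓑 g) :
    conjMap w f = conjMap z f := by
  obtain ⟨c, hc⟩ := hd.exists_ι_eq_inv_mul hw hz
  ext v
  rw [conjMap_apply, ← Units.mul_inv_cancel_right (↑w⁻¹ : B) z, ← hc, mul_smul, hf, hc, ← mul_smul,
    Units.mul_inv_cancel_left, conjMap_apply]

end ConjMap

section Averaging

variable [Fintype G] (hd) in
/-- The `ξ`-isotypic component of a linear map under the conjugation action of `G`. -/
def isotypicPart (ξ : G →* Kˣ) (f : V →ₗ[K] W) : V →ₗ[K] W :=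
  (Nat.card G : K)⁻¹ • ∑ g, (↑(ξ g)⁻¹ : K) • conjMap (hd.unit g) f

theorem isTwistedHom_isotypicPart [Fintype G] {f : V →ₗ[K] W} (hf : f ∈ homOver ι V W)
    (ξ : G →* Kˣ) : IsTwistedHom hd ξ (isotypicPart hd ξ f) := by
  refine .of_conjMap_eq_smul (Submodule.smul_mem _ _ <| Submodule.sum_mem _ fun g _ =>
    Submodule.smul_mem _ _ (conjMap_unit_mem_homOver hd hf g)) fun h => ?_
  have hconj (g : G) : conjMap (hd.unit h) (conjMap (hd.unit g) f) =
      conjMap (hd.unit (h * g)) f := by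
    rw [← conjMap_mul]
    exact conjMap_eq_of_mem hd hf (hd.mul_mem (hd.unit_mem h) (hd.unit_mem g)) (hd.unit_mem _)
  simp only [isotypicPart, map_smul, map_sum, hconj]
  rw [smul_comm (ξ h : K), Finset.smul_sum (r := (ξ h : K)), ← Equiv.sum_comp (Equiv.mulLeft h)
    fun g => (ξ h : K) • (↑(ξ g)⁻¹ : K) • conjMap (hd.unit g) f]
  congr 1
  refine Finset.sum_congr rfl fun g _ => ?_
  rw [Equiv.coe_mulLeft, map_mul, mul_inv, Units.val_mul, smul_smul,
    Units.mul_inv_cancel_left]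

variable [Finite G] [IsCyclic G] [HasEnoughRootsOfUnity K (Nat.card G)]

theorem sum_isotypicPart [Fintype G] [Fintype (G →* Kˣ)] (hd : IsCrossedProduct ι 𝓑)
    {f : V →ₗ[K] W} (hf : f ∈ homOver ι V W) : ∑ ξ, isotypicPart hd ξ f = f := by
  have horth (g : G) (hg : g ≠ 1) : ∑ ξ : G →* Kˣ, (↑(ξ g)⁻¹ : K) = 0 := by
    simpa only [map_inv] using sum_linearCharacters_apply (K := K) (inv_ne_one.2 hg)
  calc ∑ ξ, isotypicPart hd ξ f
      = (Nat.card G : K)⁻¹ • ∑ g, (∑ ξ : G →* Kˣ, (↑(ξ g)⁻¹ : K)) • conjMap (hd.unit g) f := by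
        simp only [isotypicPart, ← Finset.smul_sum, Finset.sum_smul]
        rw [Finset.sum_comm]
    _ = (Nat.card G : K)⁻¹ • (Nat.card G : K) • conjMap (hd.unit 1) f := by
        rw [Finset.sum_eq_single 1 (fun g _ hg => by rw [horth g hg, zero_smul]) (by simp),
          ← card_linearCharacters G K]
        simp
    _ = f := by
        rw [smul_smul, inv_mul_cancel₀ (natCast_card_ne_zero G K), one_smul,
          conjMap_eq_of_mem hd hf (hd.unit_mem 1) (z := 1) hd.one_mem, conjMap_one]

theorem homOver_eq_span_isTwistedHom (hd : IsCrossedProduct ι 𝓑) :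
    homOver ι V W = Submodule.span K {f | ∃ ξ, IsTwistedHom hd ξ f} := by
  have := Fintype.ofFinite G
  have := finite_linearCharacters G K
  have := Fintype.ofFinite (G →* Kˣ)
  refine le_antisymm (fun f hf => ?_) (Submodule.span_le.2 fun f ⟨ξ, hf⟩ => hf.mem_homOver)
  rw [← sum_isotypicPart hd hf]
  exact Submodule.sum_mem _ fun ξ _ => Submodule.subset_span ⟨ξ, isTwistedHom_isotypicPart hf ξ⟩

end Averaging

section Simple

variable [IsSimpleModule B V] [IsSimpleModule B W]

theorem IsTwistedHom.character_eq {f : V →ₗ[K] W} (hf : IsTwistedHom hd ξ f) (hne : f ≠ 0) :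
    character K B W = character K B V ∘ₗ (hd.twist ξ).toLinearMap := by
  rw [← character_res]
  exact (character_congr (LinearEquiv.ofBijective hf.toHom (hf.bijective hne))).symm

variable [Module.Finite K B] (hB : IsSplitSemisimple K B)
include hB

theorem exists_isTwistedHom
    (hVW : character K B W = character K B V ∘ₗ (hd.twist ξ).toLinearMap) :
    ∃ f : V →ₗ[K] W, IsTwistedHom hd ξ f ∧ f ≠ 0 := by
  have := isSimpleModule_res (V := V) (hd.twist_surjective ξ)
  obtain ⟨e⟩ := hB.nonempty_linearEquiv_of_character_eq (Res (hd.twist ξ) V) W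
    (character_res.trans hVW.symm)
  have := IsSimpleModule.nontrivial B V
  refine ⟨e.toLinearMap.restrictScalars K ∘ₗ (toRes (hd.twist ξ) V).toLinearMap,
    fun b v => e.map_smul b (toRes (hd.twist ξ) V v), fun h => ?_⟩
  obtain ⟨v, hv⟩ := exists_ne (0 : V)
  exact hv (e.map_eq_zero_iff.1 (LinearMap.congr_fun h v))

end Simple

section Endomorphisms

variable [IsSimpleModule B V] (hB : IsSplitSemisimple K B)
  [Finite G] [IsCyclic G] [HasEnoughRootsOfUnity K (Nat.card G)]
include hB

theorem homOver_eq_span_range (hd : IsCrossedProduct ι 𝓑)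
    {T : hd.twistStabilizer (character K B V) → Module.End K V}
    (hT : ∀ ξ, IsTwistedHom hd ξ.1 (T ξ)) (hT_ne : ∀ ξ, T ξ ≠ 0) :
    homOver ι V V = Submodule.span K (Set.range T) := by
  rw [homOver_eq_span_isTwistedHom hd]
  refine le_antisymm (Submodule.span_le.2 ?_) (Submodule.span_mono ?_)
  · rintro f ⟨ξ, hf⟩
    obtain rfl | hf_ne := eq_or_ne f 0
    · exact zero_mem _
    let ξ' : hd.twistStabilizer (character K B V) :=
      ⟨ξ, hd.mem_twistStabilizer.2 (hf.character_eq hf_ne).symm⟩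
    obtain ⟨c, hc⟩ := (hT ξ').exists_eq_smul hB hf (hT_ne ξ')
    exact hc ▸ Submodule.smul_mem _ c (Submodule.subset_span ⟨ξ', rfl⟩)
  · rintro _ ⟨ξ, rfl⟩
    exact ⟨ξ.1, hT ξ⟩

variable [Module.Finite K B]

theorem exists_homOver_le_adjoin (hd : IsCrossedProduct ι 𝓑) :
    ∃ T : Module.End K V, homOver ι V V ≤ (Algebra.adjoin K {T}).toSubmodule := by
  have := isCyclic_linearCharacters G K
  have := finite_linearCharacters G K
  obtain ⟨ξ₀, hξ₀⟩ := IsCyclic.exists_monoid_generator (α := hd.twistStabilizer (character K B V))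
  obtain ⟨T, hT, hT_ne⟩ :=
    exists_isTwistedHom (V := V) (W := V) hB (hd.mem_twistStabilizer.1 ξ₀.2).symm
  refine ⟨T, ?_⟩
  rw [homOver_eq_span_isTwistedHom hd, Submodule.span_le]
  rintro f ⟨ξ, hf⟩
  obtain rfl | hf_ne := eq_or_ne f 0
  · exact zero_mem _
  obtain ⟨k, hk⟩ := Submonoid.mem_powers_iff _ _ |>.1 <|
    hξ₀ ⟨ξ, hd.mem_twistStabilizer.2 (hf.character_eq hf_ne).symm⟩
  have hξ : ξ₀.1 ^ k = ξ := congrArg Subtype.val hk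
  have := IsSimpleModule.nontrivial B V
  have hTk : T ^ k ≠ 0 := fun h => by
    obtain ⟨v, hv⟩ := exists_ne (0 : V)
    refine hv ((hT.bijective hT_ne).injective.iterate k ?_)
    rw [← Module.End.coe_pow, h, LinearMap.zero_apply, LinearMap.zero_apply]
  obtain ⟨c, rfl⟩ := (hξ ▸ hT.pow k).exists_eq_smul hB hf hTk
  exact Subalgebra.smul_mem _ (pow_mem (Algebra.self_mem_adjoin_singleton K T) k) c

theorem commute_end_res (hd : IsCrossedProduct ι 𝓑) (f g : Module.End C (Res ι V)) :
    Commute f g := by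
  obtain ⟨T, hT⟩ := exists_homOver_le_adjoin (V := V) hB hd
  have hcomm := congrArg Subtype.val <|
    mul_comm (⟨_, hT (homOverEquiv ι V V f).2⟩ : Algebra.adjoin K {T})
      ⟨_, hT (homOverEquiv ι V V g).2⟩
  exact LinearMap.ext fun v => LinearMap.congr_fun hcomm ((toRes ι V).symm v)

theorem finrank_end_res (hd : IsCrossedProduct ι 𝓑) :
    Module.finrank K (Module.End C (Res ι V)) =
      Nat.card (hd.twistStabilizer (character K B V)) := by
  have := finite_linearCharacters G K
  have := Fintype.ofFinite (hd.twistStabilizer (character K B V))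
  obtain ⟨g, hg⟩ := IsCyclic.exists_generator (α := G)
  have hexists (ξ : hd.twistStabilizer (character K B V)) :
      ∃ f : Module.End K V, IsTwistedHom hd ξ.1 f ∧ f ≠ 0 :=
    exists_isTwistedHom hB (hd.mem_twistStabilizer.1 ξ.2).symm
  choose T hT hT_ne using hexists
  have hT_indep : LinearIndependent K T := by
    refine Module.End.eigenvectors_linearIndependent' (conjMap (hd.unit g))
      (fun ξ => (ξ.1 g : K)) (fun ξ η hξη => Subtype.ext ?_) T fun ξ => ⟨?_, hT_ne ξ⟩
    · exact (MonoidHom.eq_iff_eq_on_generator hg ξ.1 η.1).2 (Units.ext hξη)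
    · exact Module.End.mem_eigenspace_iff.2 ((hT ξ).conjMap_eq_smul (hd.unit_mem g))
  rw [(homOverEquiv ι V V).finrank_eq, homOver_eq_span_range hB hd hT hT_ne,
    finrank_span_eq_card hT_indep, Nat.card_eq_fintype_card]

end Endomorphisms

end TwistedHom

section CliffordTheory

variable {K : Type v} [Field K] {C B : Type u} [Ring C] [Algebra K C] [Ring B] [Algebra K B]
  {G : Type*} [Group G] [DecidableEq G] {ι : C →ₐ[K] B} {𝓑 : G → Submodule K B}

/-- The irreducible character `χ` of `B` lies over the irreducible character `ψ` of `C` if `ψ`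
occurs in the restriction along `ι : C → B` of a simple module of character `χ`. -/
def LiesOver (ι : C →ₐ[K] B) (χ : Module.Dual K B) (ψ : Module.Dual K C) : Prop :=
  ∃ (V : Type u) (_ : AddCommGroup V) (_ : Module K V) (_ : Module B V) (_ : IsScalarTower K B V),
    IsSimpleModule B V ∧ character K B V = χ ∧ ψ ∈ constituents K C (Res ι V)

section Constituents

variable {V W : Type u} [AddCommGroup V] [Module K V] [Module B V] [IsScalarTower K B V]
  [AddCommGroup W] [Module K W] [Module B W] [IsScalarTower K B W]
  [IsSimpleModule B V] [IsSimpleModule B W] [Module.Finite K C]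
  (hd : IsCrossedProduct ι 𝓑) (hC : IsSplitSemisimple K C)
include hd hC

omit hd [IsSimpleModule B V] in
theorem mem_constituents_res_iff {ψ : Module.Dual K C} :
    ψ ∈ constituents K C (Res ι V) ↔ ψ ∈ Irr K C ∧ ∃ v : V, ι (block ψ) • v ≠ 0 :=
  hC.mem_constituents_iff

theorem constituents_res_eq_conjOrbit {ψ : Module.Dual K C}
    (hψ : ψ ∈ constituents K C (Res ι V)) : constituents K C (Res ι V) = hd.conjOrbit ψ := by
  obtain ⟨hψ_irr, v, hv⟩ := (mem_constituents_res_iff hC).1 hψ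
  refine subset_antisymm (fun φ hφ => ?_) ?_
  · obtain ⟨hφ_irr, x, hx⟩ := (mem_constituents_res_iff hC).1 hφ
    by_contra hφψ
    have hkill (b : B) : ι (block φ) • b • ι (block ψ) • v = 0 := by
      induction b using hd.induction_on with
      | hmem g b hb =>
        have hne : φ ≠ ψ ∘ₗ (hd.conj g).toLinearMap := fun h => hφψ ⟨g, h.symm⟩
        rw [smul_smul b, ← hd.ι_block_mul_of_mem hC hψ_irr hb, ← mul_smul, ← mul_assoc, ← map_mul,
          hC.block_mul_of_ne hφ_irr (hd.conjOrbit_subset_irr hψ_irr ⟨g, rfl⟩) hne, map_zero,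
          zero_mul, zero_smul]
      | hadd b b' hb hb' => rw [add_smul, smul_add, hb, hb', add_zero]
    obtain ⟨b, rfl⟩ := IsSimpleModule.toSpanSingleton_surjective B hv x
    exact hx (hkill b)
  · rintro _ ⟨g, rfl⟩
    refine (mem_constituents_res_iff hC).2
      ⟨hd.conjOrbit_subset_irr hψ_irr ⟨g, rfl⟩, (hd.unit g : B) • v, fun h => hv ?_⟩
    rw [← mul_smul, hd.ι_block_mul_of_mem hC hψ_irr (hd.unit_mem g), mul_smul] at h
    exact (hd.unit g).isUnit.smul_eq_zero.1 h

theorem constituents_res_subset [Module.Finite K B] (hB : IsSplitSemisimple K B) {ξ : G →* Kˣ}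
    (h : character K B W = character K B V ∘ₗ (hd.twist ξ).toLinearMap) :
    constituents K C (Res ι V) ⊆ constituents K C (Res ι W) := by
  obtain ⟨f, hf, hf_ne⟩ := exists_isTwistedHom hB h
  intro ψ hψ
  obtain ⟨hψ_irr, v, hv⟩ := (mem_constituents_res_iff hC).1 hψ
  refine (mem_constituents_res_iff hC).2 ⟨hψ_irr, f v, fun h => hv ?_⟩
  rw [← hf.mem_homOver] at h
  exact (hf.bijective hf_ne).injective (h.trans (map_zero f).symm)

theorem exists_character_eq_comp_twist [Finite G] [IsCyclic G]
    [HasEnoughRootsOfUnity K (Nat.card G)] {ψ : Module.Dual K C}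
    (hV : ψ ∈ constituents K C (Res ι V)) (hW : ψ ∈ constituents K C (Res ι W)) :
    ∃ ξ : G →* Kˣ, character K B W = character K B V ∘ₗ (hd.twist ξ).toLinearMap := by
  have := hC.1
  obtain ⟨X, hX, rfl⟩ := hV
  obtain ⟨Y, hY, hXY⟩ := hW
  obtain ⟨e⟩ := hC.nonempty_linearEquiv_of_character_eq X Y hXY.symm
  obtain ⟨X', hX'⟩ := exists_isCompl X
  let f : Res ι V →ₗ[C] Res ι W := Y.subtype ∘ₗ e.toLinearMap ∘ₗ X.projectionOnto X' hX'
  have hf : f ≠ 0 := fun h => by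
    have := IsSimpleModule.nontrivial C X
    obtain ⟨x, hx⟩ := exists_ne (0 : X)
    have hfx : f x = 0 := LinearMap.congr_fun h x
    simp only [f, LinearMap.comp_apply, Submodule.projectionOnto_apply_left] at hfx
    exact hx (by simpa using hfx)
  by_contra! hne
  have hbot : homOver ι V W = ⊥ := by
    rw [homOver_eq_span_isTwistedHom hd, Submodule.span_eq_bot]
    rintro T ⟨ξ, hT⟩
    exact by_contra fun hT_ne => hne ξ (hT.character_eq hT_ne)
  refine hf ((homOverEquiv ι V W).injective (Subtype.ext ?_))
  rw [map_zero]
  exact (Submodule.eq_bot_iff _).1 hbot _ (homOverEquiv ι V W f).2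

omit hd in
theorem liesOver_character_iff [Module.Finite K B] (hB : IsSplitSemisimple K B)
    {ψ : Module.Dual K C} :
    LiesOver ι (character K B V) ψ ↔ ψ ∈ constituents K C (Res ι V) := by
  refine ⟨fun ⟨W, _, _, _, _, _, hWV, hψ⟩ => ?_, fun hψ => ⟨V, _, _, _, _, ‹_›, rfl, hψ⟩⟩
  obtain ⟨e⟩ := hB.nonempty_linearEquiv_of_character_eq W V hWV
  obtain ⟨hψ_irr, w, hw⟩ := (mem_constituents_res_iff hC).1 hψ
  refine (mem_constituents_res_iff hC).2 ⟨hψ_irr, e w, ?_⟩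
  rwa [← map_smul, e.map_ne_zero_iff]

end Constituents

theorem LiesOver.mem_irr_left {χ : Module.Dual K B} {ψ : Module.Dual K C}
    (h : LiesOver ι χ ψ) : χ ∈ Irr K B :=
  let ⟨V, _, _, _, _, hV, hχ, _⟩ := h
  ⟨V, _, _, _, _, hV, hχ⟩

theorem LiesOver.mem_irr_right {χ : Module.Dual K B} {ψ : Module.Dual K C}
    (h : LiesOver ι χ ψ) : ψ ∈ Irr K C :=
  let ⟨_, _, _, _, _, _, _, hψ⟩ := h
  constituents_subset_irr hψ

theorem exists_liesOver_right [IsSemisimpleRing C] {χ : Module.Dual K B} (hχ : χ ∈ Irr K B) :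
    ∃ ψ : Module.Dual K C, LiesOver ι χ ψ := by
  obtain ⟨V, _, _, _, _, hV, rfl⟩ := hχ
  have : Nontrivial (Res ι V) := IsSimpleModule.nontrivial B V
  obtain ⟨ψ, hψ⟩ := nonempty_constituents (K := K) (C := C) (M := Res ι V)
  exact ⟨ψ, V, _, _, _, _, hV, rfl, hψ⟩

section Orbits

variable [Module.Finite K C] [Module.Finite K B] (hC : IsSplitSemisimple K C)
  (hB : IsSplitSemisimple K B)
include hC hB

theorem exists_liesOver_left (hι : Function.Injective ι) {ψ : Module.Dual K C}
    (hψ : ψ ∈ Irr K C) : ∃ χ : Module.Dual K B, LiesOver ι χ ψ := by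
  by_contra! hne
  refine hC.block_ne_zero hψ (hι (hB.eq_of_forall_simple fun V _ _ _ _ _ v => ?_))
  rw [map_zero, zero_smul]
  exact hC.block_smul_of_notMem_constituents hψ
    (fun h => hne _ ((liesOver_character_iff hC hB).2 h)) (toRes ι V v)

variable (hd : IsCrossedProduct ι 𝓑) {χ χ' : Module.Dual K B} {ψ ψ' : Module.Dual K C}
  (h : LiesOver ι χ ψ)
include hd h

theorem LiesOver.mem_conjOrbit_iff : ψ' ∈ hd.conjOrbit ψ ↔ LiesOver ι χ ψ' := by
  obtain ⟨V, _, _, _, _, hV, rfl, hψ⟩ := h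
  rw [← constituents_res_eq_conjOrbit hd hC hψ, liesOver_character_iff hC hB]

variable [Finite G] [IsCyclic G] [HasEnoughRootsOfUnity K (Nat.card G)]

theorem LiesOver.comp_eq_finsum : χ ∘ₗ ι.toLinearMap = ∑ᶠ ψ' ∈ hd.conjOrbit ψ, ψ' := by
  obtain ⟨V, _, _, _, _, hV, rfl, hψ⟩ := h
  have : Module.Finite K (Res ι V) := finite_of_isSimpleModule K (B := B) (V := V)
  rw [← character_res, hC.character_eq_finsum_constituents (commute_end_res hB hd),
    constituents_res_eq_conjOrbit hd hC hψ]

theorem LiesOver.ncard_mul_ncard :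
    (hd.conjOrbit ψ).ncard * (hd.twistOrbit χ).ncard = Nat.card G := by
  obtain ⟨V, _, _, _, _, hV, rfl, hψ⟩ := h
  rw [← constituents_res_eq_conjOrbit hd hC hψ,
    ← hC.finrank_end_eq_ncard_constituents (commute_end_res hB hd), finrank_end_res hB hd,
    hd.card_twistStabilizer_mul_ncard_twistOrbit]

theorem LiesOver.mem_twistOrbit_iff : χ' ∈ hd.twistOrbit χ ↔ LiesOver ι χ' ψ := by
  have hχ := h.mem_irr_left
  obtain ⟨V, _, _, _, _, hV, rfl, hψ⟩ := h
  constructor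
  · intro hχ'
    obtain ⟨W, _, _, _, _, hW, rfl⟩ := hd.twistOrbit_subset_irr hχ hχ'
    obtain ⟨ξ, hξ⟩ := hχ'
    exact (liesOver_character_iff hC hB).2 (constituents_res_subset hd hC hB hξ.symm hψ)
  · rintro ⟨W, _, _, _, _, hW, rfl, hψW⟩
    obtain ⟨ξ, hξ⟩ := exists_character_eq_comp_twist hd hC hψ hψW
    exact ⟨ξ, hξ.symm⟩

theorem LiesOver.finsum_ι_block :
    ∑ᶠ ψ' ∈ hd.conjOrbit ψ, ι (block ψ') = ∑ᶠ χ' ∈ hd.twistOrbit χ, block χ' := by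
  have hψs := hd.conjOrbit_subset_irr h.mem_irr_right
  have hχs := hd.twistOrbit_subset_irr h.mem_irr_left
  rw [finsum_mem_eq_finite_toFinset_sum _ (hC.finite_irr.subset hψs),
    finsum_mem_eq_finite_toFinset_sum _ (hB.finite_irr.subset hχs), ← map_sum]
  refine hB.eq_of_forall_simple fun W _ _ _ _ _ w => ?_
  by_cases hW : LiesOver ι (character K B W) ψ
  · rw [hB.sum_block_smul_of_mem (by simpa using hχs)
      (by simpa using (h.mem_twistOrbit_iff hC hB hd).2 hW)]
    refine hC.sum_block_smul_of_constituents_subset (M := Res ι W) (by simpa using hψs) ?_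
      (toRes ι W w)
    rw [constituents_res_eq_conjOrbit hd hC ((liesOver_character_iff hC hB).1 hW),
      Set.Finite.coe_toFinset]
  · rw [hB.sum_block_smul_of_notMem (by simpa using hχs)
      (by simpa using fun hW' => hW ((h.mem_twistOrbit_iff hC hB hd).1 hW')), map_sum,
      Finset.sum_smul]
    refine Finset.sum_eq_zero fun ψ' hψ' => ?_
    rw [Set.Finite.mem_toFinset] at hψ'
    refine hC.block_smul_of_notMem_constituents (M := Res ι W) (hψs hψ') (fun hψ'W => hW ?_)
      (toRes ι W w)
    have hWψ' := (liesOver_character_iff hC hB).2 hψ'W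
    exact (hWψ'.mem_conjOrbit_iff hC hB hd).1 <| by
      rw [hd.conjOrbit_eq_of_mem h.mem_irr_right hψ']
      exact ((h.mem_conjOrbit_iff hC hB hd).2 h)

end Orbits

section SchurElement

variable (hd : IsCrossedProduct ι 𝓑) {χ : Module.Dual K B} {ψ : Module.Dual K C}
  {T : B →ₗ[K] K}

theorem apply_eq_apply_proj_one (hT₀ : ∀ g ≠ 1, ∀ b ∈ 𝓑 g, T b = 0) (b : B) :
    T b = T (hd.proj 1 b) := by
  induction b using hd.induction_on with
  | hmem g b hb =>
    obtain rfl | hg := eq_or_ne g 1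
    · rw [hd.proj_of_mem hb]
    · rw [hT₀ g hg b hb, hd.proj_of_ne hb hg.symm, map_zero]
  | hadd b b' hb hb' => simp only [map_add, hb, hb']

variable [Module.Finite K C] [Module.Finite K B] (hC : IsSplitSemisimple K C)
  (hB : IsSplitSemisimple K B) [Finite G] [IsCyclic G] [HasEnoughRootsOfUnity K (Nat.card G)]
  (hT : IsSymmetrizingForm T) (hT' : IsSymmetrizingForm (T ∘ₗ ι.toLinearMap))
  (hT₀ : ∀ g ≠ 1, ∀ b ∈ 𝓑 g, T b = 0) (h : LiesOver ι χ ψ)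
include hC hB hT hT' hT₀ h

theorem LiesOver.finsum_dualElement :
    ∑ᶠ χ' ∈ hd.twistOrbit χ, dualElement T χ' = ((hd.twistOrbit χ).ncard : K) •
      ι (∑ᶠ ψ' ∈ hd.conjOrbit ψ, dualElement (T ∘ₗ ι.toLinearMap) ψ') := by
  have hψs := hC.finite_irr.subset (hd.conjOrbit_subset_irr h.mem_irr_right)
  have hχs := hB.finite_irr.subset (hd.twistOrbit_subset_irr h.mem_irr_left)
  refine hT.ext fun b => ?_
  obtain ⟨c, hc⟩ := (hd.mem_one _).1 (hd.proj_mem 1 b)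
  calc T ((∑ᶠ χ' ∈ hd.twistOrbit χ, dualElement T χ') * b)
      = (∑ᶠ χ' ∈ hd.twistOrbit χ, χ') b := by
        rw [finsum_mem_eq_finite_toFinset_sum _ hχs, finsum_mem_eq_finite_toFinset_sum _ hχs]
        simp only [Finset.sum_mul, map_sum, hT.apply_dualElement_mul, LinearMap.sum_apply]
    _ = ((hd.twistOrbit χ).ncard : K) * (∑ᶠ ψ' ∈ hd.conjOrbit ψ, ψ') c := by
        rw [hd.finsum_twistOrbit_apply, ← hc, ← h.comp_eq_finsum hC hB hd]
        rfl
    _ = ((hd.twistOrbit χ).ncard : K) * (T ∘ₗ ι.toLinearMap)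
          ((∑ᶠ ψ' ∈ hd.conjOrbit ψ, dualElement (T ∘ₗ ι.toLinearMap) ψ') * c) := by
        rw [finsum_mem_eq_finite_toFinset_sum _ hψs, finsum_mem_eq_finite_toFinset_sum _ hψs]
        simp only [Finset.sum_mul, map_sum, hT'.apply_dualElement_mul, LinearMap.sum_apply]
    _ = _ := by
        rw [smul_mul_assoc, map_smul, smul_eq_mul, apply_eq_apply_proj_one hd hT₀ (_ * b),
          hd.proj_ι_mul, ← hc, ← map_mul]
        rfl

theorem LiesOver.centralValue_dualElement :
    centralValue χ (dualElement T χ) = ((hd.twistOrbit χ).ncard : K) *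
      centralValue ψ (dualElement (T ∘ₗ ι.toLinearMap) ψ) := by
  have hψs := hd.conjOrbit_subset_irr h.mem_irr_right
  have hχs := hd.twistOrbit_subset_irr h.mem_irr_left
  have hsum := h.finsum_dualElement hd hC hB hT hT' hT₀
  have hψ_mem := (h.mem_conjOrbit_iff hC hB hd).2 h
  rw [finsum_mem_eq_finite_toFinset_sum _ (hC.finite_irr.subset hψs),
    finsum_mem_eq_finite_toFinset_sum _ (hB.finite_irr.subset hχs)] at hsum
  obtain ⟨V, _, _, _, _, hV, rfl, X, hX, rfl⟩ := h
  have := IsSimpleModule.nontrivial C X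
  obtain ⟨x, hx⟩ := exists_ne (0 : X)
  have hv_ne : (toRes ι V).symm x ≠ 0 := fun hv => hx (Subtype.ext hv)
  have hv := hT.sum_dualElement_smul hB (s := (hB.finite_irr.subset hχs).toFinset)
    (by simpa using hχs) (by simpa using hd.self_mem_twistOrbit _) ((toRes ι V).symm x)
  have hx' : ι _ • (toRes ι V).symm x = (_ : K) • (toRes ι V).symm x :=
    congrArg Subtype.val <| hT'.sum_dualElement_smul hC
      (s := (hC.finite_irr.subset hψs).toFinset) (by simpa using hψs) (by simpa using hψ_mem) x
  rw [hsum, smul_assoc, hx'] at hv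
  refine (smul_left_injective K hv_ne ?_).symm
  simpa only [mul_smul] using hv

end SchurElement

end CliffordTheory

section Induction

variable {K : Type v} [Field K]

theorem trace_pi {X ι : Type*} [Fintype ι] [DecidableEq ι] [AddCommGroup X] [Module K X]
    [Module.Finite K X] (f : Module.End K (ι → X)) :
    LinearMap.trace K (ι → X) f = ∑ i, LinearMap.trace K X
      (LinearMap.proj i ∘ₗ f ∘ₗ LinearMap.single K (fun _ => X) i) := by
  have hf : f = ∑ i, (f ∘ₗ LinearMap.single K (fun _ => X) i) ∘ₗ LinearMap.proj i := by
    refine LinearMap.ext fun x => ?_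
    conv_lhs => rw [← Finset.univ_sum_single x, map_sum]
    rw [LinearMap.sum_apply]
    rfl
  conv_lhs => rw [hf, map_sum]
  exact Finset.sum_congr rfl fun i _ => LinearMap.trace_comp_comm' _ _

variable {C B : Type u} [Ring C] [Algebra K C] [Ring B] [Algebra K B]
  {G : Type*} [Group G] [DecidableEq G] {ι : C →ₐ[K] B} {𝓑 : G → Submodule K B}

namespace IsCrossedProduct

variable (hd : IsCrossedProduct ι 𝓑)
include hd

/-- The component of degree `1` of an element of `B`, as an element of `C`. -/
def coeff : B →ₗ[K] C :=
  (LinearEquiv.ofInjective ι.toLinearMap hd.injective).symm.toLinearMap ∘ₗ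
    (hd.proj 1).codRestrict ι.toLinearMap.range fun b => (hd.mem_one _).1 (hd.proj_mem 1 b)

theorem ι_coeff (b : B) : ι (hd.coeff b) = hd.proj 1 b :=
  congrArg Subtype.val <|
    (LinearEquiv.ofInjective ι.toLinearMap hd.injective).apply_symm_apply _

theorem coeff_one : hd.coeff 1 = 1 :=
  hd.injective (by rw [hd.ι_coeff, hd.proj_of_mem hd.one_mem, map_one])

theorem coeff_mul_ι (b : B) (c : C) : hd.coeff (b * ι c) = hd.coeff b * c := by
  refine hd.injective ?_
  rw [map_mul ι, hd.ι_coeff, hd.ι_coeff, ← hd.proj_mul_of_mem_right (hd.ι_mem c), mul_one]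

theorem ι_coeff_unit_inv_mul (g : G) (b : B) :
    ι (hd.coeff (↑(hd.unit g)⁻¹ * b)) = ↑(hd.unit g)⁻¹ * hd.proj g b := by
  rw [hd.ι_coeff, ← hd.proj_mul_of_mem_left (hd.inv_mem (hd.unit_mem g)), inv_mul_cancel]

theorem coeff_unit_inv_mul_mul_unit (g : G) (b : B) :
    hd.coeff (↑(hd.unit g)⁻¹ * (b * hd.unit g)) = hd.conj g (hd.coeff b) := by
  refine hd.injective ?_
  have hproj := hd.proj_mul_of_mem_right (hd.unit_mem g) 1 b
  rw [one_mul] at hproj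
  rw [hd.ι_coeff_unit_inv_mul, hd.ι_conj, hd.ι_coeff, hproj, mul_assoc]

theorem sum_unit_mul_ι_coeff [Fintype G] (b : B) :
    ∑ g, (hd.unit g : B) * ι (hd.coeff (↑(hd.unit g)⁻¹ * b)) = b := by
  simp only [hd.ι_coeff_unit_inv_mul, Units.mul_inv_cancel_left]
  induction b using hd.induction_on with
  | hmem h b hb =>
    rw [Finset.sum_eq_single h (fun g _ hne => hd.proj_of_ne hb hne) (by simp), hd.proj_of_mem hb]
  | hadd b b' hb hb' => simp only [map_add, Finset.sum_add_distrib, hb, hb']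

variable (X : Type u) [AddCommGroup X] [Module K X] [Module C X]

section

variable [Fintype G]

/-- The element of the induced module with given coordinates. -/
def indOfCoord : (G → X) →ₗ[K] Ind ι X :=
  ∑ g, ((indRelations ι X).mkQ.restrictScalars K) ∘ₗ TensorProduct.mk K B X (hd.unit g) ∘ₗ
    LinearMap.proj g

variable {X}

theorem indOfCoord_apply (x : G → X) :
    hd.indOfCoord X x = ∑ g, Submodule.Quotient.mk ((hd.unit g : B) ⊗ₜ[K] x g) := by
  simp [indOfCoord]

theorem indOfCoord_single (g : G) (x : X) :
    hd.indOfCoord X (Pi.single g x) = Submodule.Quotient.mk ((hd.unit g : B) ⊗ₜ[K] x) := by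
  rw [indOfCoord_apply, Finset.sum_eq_single g (fun h _ hne => ?_) (by simp), Pi.single_eq_same]
  rw [Pi.single_eq_of_ne hne, TensorProduct.tmul_zero, Submodule.Quotient.mk_zero]

end

variable [IsScalarTower K C X]

/-- The coordinates of an element of `B ⊗[K] X` in the decomposition of the induced module that
comes from `B = ⨁ g, unit g * C`. -/
def tensorCoord : B ⊗[K] X →ₗ[K] (G → X) :=
  LinearMap.pi fun g => TensorProduct.lift <|
    (Algebra.lsmul K K X : C →ₐ[K] Module.End K X).toLinearMap ∘ₗ hd.coeff ∘ₗ
      LinearMap.mulLeft K (↑(hd.unit g)⁻¹ : B)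

variable {X}

theorem tensorCoord_tmul (b : B) (x : X) (g : G) :
    hd.tensorCoord X (b ⊗ₜ x) g = hd.coeff (↑(hd.unit g)⁻¹ * b) • x := rfl

theorem tensorCoord_smul_eq_zero (b : B) {z : B ⊗[K] X} (hz : z ∈ indRelations ι X) :
    hd.tensorCoord X (b • z) = 0 := by
  induction hz using Submodule.span_induction generalizing b with
  | mem z hz =>
    obtain ⟨b', c, x, rfl⟩ := hz
    ext g
    rw [smul_sub, TensorProduct.smul_tmul', TensorProduct.smul_tmul', map_sub, Pi.sub_apply,
      hd.tensorCoord_tmul, hd.tensorCoord_tmul, smul_eq_mul, smul_eq_mul, ← mul_assoc,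
      ← mul_assoc, hd.coeff_mul_ι, mul_smul, mul_assoc, sub_self, Pi.zero_apply]
  | zero => rw [smul_zero, map_zero]
  | add z z' _ _ hz hz' => rw [smul_add, map_add, hz, hz', add_zero]
  | smul b' z _ hz => rw [← mul_smul, hz]

variable (X)

/-- The coordinates of an element of the induced module. -/
def indCoord : Ind ι X →ₗ[K] (G → X) :=
  ((indRelations ι X).restrictScalars K).liftQ (hd.tensorCoord X)
      (fun z hz => by simpa using hd.tensorCoord_smul_eq_zero 1 hz) ∘ₗ
    (Submodule.Quotient.restrictScalarsEquiv K (indRelations ι X)).symm.toLinearMap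

variable {X}

theorem indCoord_mk (z : B ⊗[K] X) :
    hd.indCoord X (Submodule.Quotient.mk z) = hd.tensorCoord X z := rfl

variable [Fintype G]

theorem indCoord_indOfCoord (x : G → X) : hd.indCoord X (hd.indOfCoord X x) = x := by
  ext h
  rw [hd.indOfCoord_apply, map_sum, Finset.sum_apply, Finset.sum_eq_single h _ (by simp)]
  · rw [hd.indCoord_mk, hd.tensorCoord_tmul, Units.inv_mul, hd.coeff_one, one_smul]
  · intro g _ hne
    have hzero : hd.coeff (↑(hd.unit h)⁻¹ * (hd.unit g : B)) = 0 := hd.injective (by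
      rw [hd.ι_coeff_unit_inv_mul, hd.proj_of_ne (hd.unit_mem g) hne.symm, mul_zero, map_zero])
    rw [hd.indCoord_mk, hd.tensorCoord_tmul, hzero, zero_smul]

theorem indOfCoord_indCoord (z : Ind ι X) : hd.indOfCoord X (hd.indCoord X z) = z := by
  obtain ⟨z, rfl⟩ := Submodule.Quotient.mk_surjective _ z
  rw [hd.indCoord_mk]
  induction z using TensorProduct.induction_on with
  | zero => rw [map_zero, map_zero, Submodule.Quotient.mk_zero]
  | add z z' hz hz' => rw [map_add, map_add, hz, hz', Submodule.Quotient.mk_add]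
  | tmul b x =>
    conv_rhs => rw [← hd.sum_unit_mul_ι_coeff b, TensorProduct.sum_tmul]
    rw [hd.indOfCoord_apply, ← Submodule.mkQ_apply, map_sum]
    refine Finset.sum_congr rfl fun g _ => ?_
    rw [hd.tensorCoord_tmul, Submodule.mkQ_apply, eq_comm, Submodule.Quotient.eq]
    exact Submodule.subset_span ⟨_, _, _, rfl⟩

variable (X)

/-- The decomposition of the induced module as `⨁ g, unit g ⊗ X`. -/
def indEquiv : Ind ι X ≃ₗ[K] (G → X) where
  __ := hd.indCoord X
  invFun := hd.indOfCoord X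
  left_inv := hd.indOfCoord_indCoord
  right_inv := hd.indCoord_indOfCoord

theorem character_ind_apply [Module.Finite K X] (b : B) :
    character K B (Ind ι X) b = ∑ g, character K C X (hd.conj g (hd.coeff b)) := by
  rw [character_apply, ← LinearMap.trace_conj' _ (hd.indEquiv X), trace_pi]
  refine Finset.sum_congr rfl fun g _ => ?_
  rw [character_apply]
  congr 1
  ext x
  change hd.indCoord X (b • hd.indOfCoord X (Pi.single g x)) g = hd.conj g (hd.coeff b) • x
  rw [hd.indOfCoord_single, ← Submodule.Quotient.mk_smul, hd.indCoord_mk,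
    TensorProduct.smul_tmul', hd.tensorCoord_tmul, smul_eq_mul, hd.coeff_unit_inv_mul_mul_unit]

end IsCrossedProduct

theorem LiesOver.character_ind [Finite G] [IsCyclic G] [HasEnoughRootsOfUnity K (Nat.card G)]
    [Module.Finite K C] [Module.Finite K B] (hC : IsSplitSemisimple K C)
    (hB : IsSplitSemisimple K B) (hd : IsCrossedProduct ι 𝓑) {X : Type u} [AddCommGroup X]
    [Module K X] [Module C X] [IsScalarTower K C X] [IsSimpleModule C X] {χ : Module.Dual K B}
    (h : LiesOver ι χ (character K C X)) :
    character K B (Ind ι X) = ∑ᶠ χ' ∈ hd.twistOrbit χ, χ' := by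
  have := Fintype.ofFinite G
  have := finite_of_isSimpleModule K (B := C) (V := X)
  have hcard : ((hd.conjOrbit (character K C X)).ncard : K) * (hd.twistOrbit χ).ncard =
      Nat.card G := by
    rw [← h.ncard_mul_ncard hC hB hd, Nat.cast_mul]
  have hne : ((hd.conjOrbit (character K C X)).ncard : K) ≠ 0 :=
    left_ne_zero_of_mul (hcard ▸ natCast_card_ne_zero G K)
  ext b
  have hsum := LinearMap.congr_fun (hd.ncard_conjOrbit_nsmul_sum h.mem_irr_right) (hd.coeff b)
  rw [← h.comp_eq_finsum hC hB hd, LinearMap.smul_apply, LinearMap.smul_apply,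
    LinearMap.sum_apply, nsmul_eq_mul, nsmul_eq_mul, ← hcard, mul_assoc] at hsum
  rw [hd.character_ind_apply, hd.finsum_twistOrbit_apply, ← hd.ι_coeff]
  exact mul_left_cancel₀ hne hsum

end Induction

section RootsOfUnity

open Polynomial

theorem orderOf_le_natDegree_of_aeval_of_eq_zero {k G : Type*} [CommSemiring k] [Monoid G] {g : G}
    {p : k[X]} (hp : p ≠ 0) (h : aeval (MonoidAlgebra.of k G g) p = 0) :
    orderOf g ≤ p.natDegree := by
  by_contra! hlt
  refine hp (leadingCoeff_eq_zero.1 ?_)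
  have hcoeff : (aeval (MonoidAlgebra.of k G g) p).coeff (g ^ p.natDegree) = p.leadingCoeff := by
    rw [aeval_eq_sum_range, MonoidAlgebra.coeff_sum, Finset.sum_apply',
      Finset.sum_eq_single p.natDegree]
    · rw [← map_pow, MonoidAlgebra.of_apply, MonoidAlgebra.coeff_smul_apply,
        MonoidAlgebra.coeff_single, Finsupp.single_eq_same, smul_eq_mul, mul_one, leadingCoeff]
    · intro i hi hne
      have hi_lt : i < orderOf g := (Finset.mem_range_succ_iff.1 hi).trans_lt hlt
      rw [← map_pow, MonoidAlgebra.of_apply, MonoidAlgebra.coeff_smul_apply,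
        MonoidAlgebra.coeff_single,
        Finsupp.single_eq_of_ne fun heq => hne (pow_injOn_Iio_orderOf hi_lt hlt heq.symm),
        smul_zero]
    · simp
  rw [← hcoeff, h]
  rfl

theorem IsSplitSemisimple.aeval_eq_zero_of_pow_eq_one {K : Type v} [Field K] {B : Type u} [Ring B]
    [Algebra K B] (hB : IsSplitSemisimple K B) {z : B} (hz : ∀ b, z * b = b * z) {n : ℕ}
    (hzn : z ^ n = 1) {p : K[X]} (hp : ∀ c, c ^ n = 1 → p.IsRoot c) : aeval z p = 0 := by
  have := hB.1
  refine eq_zero_of_forall_simple (K := K) fun V _ _ _ _ _ v => ?_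
  have := IsSimpleModule.nontrivial B V
  obtain ⟨c, hc⟩ := hB.exists_smul_eq_of_central hz V
  have hzc : Algebra.lsmul K K V z = algebraMap K (Module.End K V) c := LinearMap.ext hc
  have hcn : c ^ n = 1 := by
    apply (algebraMap K (Module.End K V)).injective
    rw [map_pow, ← hzc, ← map_pow, hzn, map_one, map_one]
  rw [← Algebra.lsmul_apply K K V, ← aeval_algHom_apply, hzc, aeval_algebraMap_apply,
    coe_aeval_eq_eval, hp c hcn, map_zero, LinearMap.zero_apply]

theorem IsSplitSemisimple.hasEnoughRootsOfUnity {K G : Type*} [Field K] [Group G] [Finite G]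
    [IsCyclic G] (h : IsSplitSemisimple K (MonoidAlgebra K G)) :
    HasEnoughRootsOfUnity K (Nat.card G) := by
  classical
  have : NeZero (Nat.card G) := ⟨Nat.card_pos.ne'⟩
  let _ : CommGroup G := IsCyclic.commGroup
  obtain ⟨g, hg⟩ := IsCyclic.exists_ofOrder_eq_natCard (α := G)
  let Z := nthRootsFinset (Nat.card G) (1 : K)
  have hroot (c : K) (hc : c ^ Nat.card G = 1) : (∏ c ∈ Z, (X - C c)).IsRoot c := by
    rw [IsRoot, eval_prod, Finset.prod_eq_zero ((mem_nthRootsFinset Nat.card_pos 1).2 hc)]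
    simp
  have hpow : MonoidAlgebra.of K G g ^ Nat.card G = 1 := by
    rw [← map_pow, ← hg, pow_orderOf_eq_one, map_one]
  have hle : Nat.card G ≤ Z.card := by
    rw [← hg, ← natDegree_finsetProd_X_sub_C_eq_card Z id]
    exact orderOf_le_natDegree_of_aeval_of_eq_zero (monic_prod_X_sub_C id Z).ne_zero
      (h.aeval_eq_zero_of_pow_eq_one (fun b => mul_comm _ b) hpow hroot)
  refine HasEnoughRootsOfUnity.of_card_le (hle.trans_eq ?_)
  rw [Nat.card_congr (rootsOfUnityEquivNthRoots K (Nat.card G)), Nat.card_eq_fintype_card,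
    Fintype.card_of_subtype Z fun x => ?_]
  rw [mem_nthRootsFinset Nat.card_pos, mem_nthRoots Nat.card_pos]

end RootsOfUnity

section ScalarExtension

variable {R : Type*} [CommRing R] {K : Type*} [Field K] [Algebra R K]

theorem eq_on_baseChange {M N : Type*} [AddCommGroup M] [Module R M] [AddCommGroup N] [Module K N]
    {f f' : K ⊗[R] M →ₗ[K] N} {𝒩 : Submodule R M} (h : ∀ m ∈ 𝒩, f (1 ⊗ₜ m) = f' (1 ⊗ₜ m))
    {x : K ⊗[R] M} (hx : x ∈ 𝒩.baseChange K) : f x = f' x := by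
  rw [Submodule.baseChange_eq_span] at hx
  refine LinearMap.eqOn_span' ?_ hx
  rintro _ ⟨m, hm, rfl⟩
  exact h m hm

variable {A : Type*} [Ring A] [Algebra R A]

theorem formExt_tmul (t : A →ₗ[R] R) (k : K) (a : A) : formExt K t (k ⊗ₜ a) = t a • k := by
  simp [formExt]

theorem formExt_comp_incl (t : A →ₗ[R] R) (S : Subalgebra R A) :
    formExt K (t ∘ₗ S.val.toLinearMap) = formExt K t ∘ₗ (incl K S).toLinearMap := by
  refine TensorProduct.AlgebraTensorModule.ext fun k a => ?_
  simp [formExt_tmul, incl]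

theorem formExt_mul_comm {t : A →ₗ[R] R} (ht : ∀ a b, t (a * b) = t (b * a)) (x y : K ⊗[R] A) :
    formExt K t (x * y) = formExt K t (y * x) := by
  induction x using TensorProduct.induction_on with
  | zero => rw [zero_mul, mul_zero]
  | add x x' hx hx' => rw [add_mul, mul_add, map_add, map_add, hx, hx']
  | tmul k a =>
    induction y using TensorProduct.induction_on with
    | zero => rw [zero_mul, mul_zero]
    | add y y' hy hy' => rw [add_mul, mul_add, map_add, map_add, hy, hy']
    | tmul l b =>
      rw [Algebra.TensorProduct.tmul_mul_tmul, Algebra.TensorProduct.tmul_mul_tmul,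
        formExt_tmul, formExt_tmul, ht, mul_comm]

theorem IsSymmetrizingForm.formExt [Module.Free R A] [Module.Finite R A] {t : A →ₗ[R] R}
    (ht : IsSymmetrizingForm t) : IsSymmetrizingForm (formExt K t) where
  trace := formExt_mul_comm ht.trace
  bijective := by
    let e : K ⊗[R] A ≃ₗ[K] Module.Dual K (K ⊗[R] A) :=
      (LinearEquiv.ofBijective (hat t) ht.bijective).baseChange R K ≪≫ₗ
        (TensorProduct.isBaseChange R A K).toDualBaseChange
    have he : hat (Clifford.formExt K t) = e.toLinearMap := by
      ext a b
      have hdual := (TensorProduct.isBaseChange R A K).toDualBaseChange_tmul 1 (hat t a) b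
      rw [one_mul, Algebra.algebraMap_eq_smul_one] at hdual
      simpa [e, hat, formExt_tmul] using hdual.symm
    rw [he]
    exact e.bijective

end ScalarExtension

section Orbits

theorem exists_equiv_image_of_rel {α β γ δ : Type*} {I : Set α} {J : Set β} {o : α → γ}
    {d : β → δ} {r : α → β → Prop} (hr : ∀ a b, r a b → a ∈ I ∧ b ∈ J)
    (hI : ∀ a ∈ I, ∃ b, r a b) (hJ : ∀ b ∈ J, ∃ a, r a b)
    (hod : ∀ a b a' b', r a b → r a' b' → (o a = o a' ↔ d b = d b')) :
    ∃ Φ : (o '' I) ≃ (d '' J), ∀ x y, Φ x = y → ∃ a b, r a b ∧ x.1 = o a ∧ y.1 = d b := by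
  have hx (x : o '' I) : ∃ a b, r a b ∧ x.1 = o a := by
    obtain ⟨_, a, ha, rfl⟩ := x
    obtain ⟨b, hab⟩ := hI a ha
    exact ⟨a, b, hab, rfl⟩
  choose a b hab hxa using hx
  refine ⟨Equiv.ofBijective (fun x => ⟨d (b x), b x, (hr _ _ (hab x)).2, rfl⟩) ⟨?_, ?_⟩, ?_⟩
  · intro x x' heq
    refine Subtype.ext ?_
    rw [hxa, hxa]
    exact (hod _ _ _ _ (hab x) (hab x')).2 (congrArg Subtype.val heq)
  · rintro ⟨_, b', hb', rfl⟩
    obtain ⟨a', hab'⟩ := hJ b' hb'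
    refine ⟨⟨o a', a', (hr _ _ hab').1, rfl⟩, Subtype.ext ?_⟩
    exact (hod _ _ _ _ (hab _) hab').1 (hxa _).symm
  · rintro x _ rfl
    exact ⟨a x, b x, hab x, hxa x, rfl⟩

theorem IsCrossedProduct.exists_equiv_orbits {K : Type v} [Field K] {C B : Type u} [Ring C]
    [Algebra K C] [Ring B] [Algebra K B] {G : Type*} [Group G] [DecidableEq G] [Finite G]
    [IsCyclic G] [HasEnoughRootsOfUnity K (Nat.card G)] [Module.Finite K C] [Module.Finite K B]
    {ι : C →ₐ[K] B} {𝓑 : G → Submodule K B} (hC : IsSplitSemisimple K C)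
    (hB : IsSplitSemisimple K B) (hd : IsCrossedProduct ι 𝓑) :
    ∃ Φ : (hd.conjOrbit '' Irr K C) ≃ (hd.twistOrbit '' Irr K B), ∀ Ωbar Ω, Φ Ωbar = Ω →
      ∃ ψ χ, LiesOver ι χ ψ ∧ Ωbar.1 = hd.conjOrbit ψ ∧ Ω.1 = hd.twistOrbit χ := by
  have := hC.1
  refine exists_equiv_image_of_rel (r := fun ψ χ => LiesOver ι χ ψ)
    (fun ψ χ h => ⟨h.mem_irr_right, h.mem_irr_left⟩)
    (fun ψ hψ => exists_liesOver_left hC hB hd.injective hψ)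
    (fun χ hχ => exists_liesOver_right hχ) fun ψ χ ψ' χ' h h' => ?_
  constructor
  · intro heq
    have hmem : ψ' ∈ hd.conjOrbit ψ := heq ▸ (h'.mem_conjOrbit_iff hC hB hd).2 h'
    have hχ := (h'.mem_twistOrbit_iff hC hB hd).2 ((h.mem_conjOrbit_iff hC hB hd).1 hmem)
    exact hd.twistOrbit_eq_of_mem hχ
  · intro heq
    have hmem : χ' ∈ hd.twistOrbit χ := heq ▸ hd.self_mem_twistOrbit χ'
    have hψ := (h'.mem_conjOrbit_iff hC hB hd).2 ((h.mem_twistOrbit_iff hC hB hd).1 hmem)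
    exact hd.conjOrbit_eq_of_mem h'.mem_irr_right hψ

end Orbits

section TwistedSymmetricAlgebra

variable {R : Type*} [CommRing R] {K : Type*} [Field K] [Algebra R K] {A : Type*} [Ring A]
  [Algebra R A]

theorem IsSymmetricSubalgebra.module_free {t : A →ₗ[R] R} {S : Subalgebra R A}
    (hS : IsSymmetricSubalgebra t S) : Module.Free R A :=
  have := hS.free_base
  have := hS.free
  .trans (S := S)

theorem IsSymmetricSubalgebra.module_finite {t : A →ₗ[R] R} {S : Subalgebra R A}
    (hS : IsSymmetricSubalgebra t S) : Module.Finite R A :=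
  have := hS.finite_base
  have := hS.finite
  .trans S A

theorem mul_mem_baseChange_mul {M N : Submodule R A} {x y : K ⊗[R] A} (hx : x ∈ M.baseChange K)
    (hy : y ∈ N.baseChange K) : x * y ∈ (M * N).baseChange K := by
  rw [Submodule.baseChange_eq_span] at hx hy ⊢
  refine Submodule.span_mono ?_
    (Submodule.span_mul_span K (_ : Set (K ⊗[R] A)) _ ▸ Submodule.mul_mem_mul hx hy)
  rintro _ ⟨_, ⟨m, hm, rfl⟩, _, ⟨n, hn, rfl⟩, rfl⟩
  exact ⟨m * n, Submodule.mul_mem_mul hm hn, by simp⟩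

namespace IsTwistedSymmetricAlgebra

variable {G : Type*} [Group G] [DecidableEq G] {t : A →ₗ[R] R} {S : Subalgebra R A}
  {𝒜 : G → Submodule R A} (hA : IsTwistedSymmetricAlgebra t S 𝒜)
include hA

theorem incl_injective : Function.Injective (incl K S) := by
  have hinj := hA.directSum.toBaseChange_injective (S := K) 𝒜 1
  rw [hA.one] at hinj
  exact Subtype.val_injective.comp hinj

theorem mem_baseChange_one {b : K ⊗[R] A} :
    b ∈ (𝒜 1).baseChange K ↔ ∃ c, incl K S c = b := by
  rw [hA.one]
  rfl

theorem exists_unit_mem_baseChange (g : G) :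
    ∃ w : (K ⊗[R] A)ˣ, (w : K ⊗[R] A) ∈ (𝒜 g).baseChange K := by
  obtain ⟨a, ha, hunit⟩ := hA.exists_unit g
  exact ⟨Units.map (Algebra.TensorProduct.includeRight : A →ₐ[R] K ⊗[R] A) hunit.unit,
    Submodule.tmul_mem_baseChange_of_mem 1 ha⟩

theorem isCrossedProduct : IsCrossedProduct (incl K S) fun g => (𝒜 g).baseChange K where
  injective := hA.incl_injective
  isInternal := hA.directSum.baseChange 𝒜
  mem_one _ := hA.mem_baseChange_one
  mul_mem ha hb := hA.mul _ _ ▸ mul_mem_baseChange_mul ha hb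
  exists_unit := hA.exists_unit_mem_baseChange

theorem formExt_eq_zero {g : G} (hg : g ≠ 1) {b : K ⊗[R] A} (hb : b ∈ (𝒜 g).baseChange K) :
    formExt K t b = 0 :=
  eq_on_baseChange (f' := 0) (fun a ha => by
    rw [formExt_tmul, hA.form_eq_zero g hg a ha, zero_smul, LinearMap.zero_apply]) hb

theorem dualOrbit_eq {χ : Module.Dual K (K ⊗[R] A)} (hχ : χ ∈ Irr K (K ⊗[R] A)) :
    dualOrbit 𝒜 χ = hA.isCrossedProduct.twistOrbit χ := by
  have hd := hA.isCrossedProduct (K := K)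
  have htwist {ξ : G →* Kˣ} {g : G} {b : K ⊗[R] A} (hb : b ∈ (𝒜 g).baseChange K) :
      χ (hd.twist ξ b) = χ b * ξ g := by
    rw [hd.twist_of_mem ξ hb, map_smul, smul_eq_mul, mul_comm]
  ext φ
  constructor
  · rintro ⟨-, ξ, hξ⟩
    refine ⟨ξ, LinearMap.ext fun b => ?_⟩
    induction b using hd.induction_on with
    | hmem g b hb =>
      refine eq_on_baseChange (fun a ha => ?_) hb
      rw [hξ g a ha]
      exact htwist (Submodule.tmul_mem_baseChange_of_mem 1 ha)
    | hadd b b' hb hb' => rw [map_add, map_add, hb, hb']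
  · rintro ⟨ξ, rfl⟩
    exact ⟨hd.twistOrbit_subset_irr hχ ⟨ξ, rfl⟩, ξ,
      fun g a ha => htwist (Submodule.tmul_mem_baseChange_of_mem 1 ha)⟩

theorem orbit_eq [Module.Finite K (K ⊗[R] S)] (hC : IsSplitSemisimple K (K ⊗[R] S))
    {ψ : Module.Dual K (K ⊗[R] S)} (hψ : ψ ∈ Irr K (K ⊗[R] S)) :
    orbit S 𝒜 ψ = hA.isCrossedProduct.conjOrbit ψ := by
  ext ψ'
  rw [hA.isCrossedProduct.mem_conjOrbit_iff hC hψ]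
  refine and_congr_right fun _ => exists_congr fun g => ?_
  exact ⟨fun h b hb => eq_on_baseChange (f := LinearMap.mulLeft K (incl K S (block ψ')))
    (f' := LinearMap.mulRight K (incl K S (block ψ))) h hb,
    fun h a ha => h _ (Submodule.tmul_mem_baseChange_of_mem 1 ha)⟩

theorem schurElement_eq [Finite G] [IsCyclic G] [HasEnoughRootsOfUnity K (Nat.card G)]
    (hC : IsSplitSemisimple K (K ⊗[R] S)) (hB : IsSplitSemisimple K (K ⊗[R] A))
    {χ : Module.Dual K (K ⊗[R] A)} {ψ : Module.Dual K (K ⊗[R] S)}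
    (h : LiesOver (incl K S) χ ψ) :
    schurElement t χ = ((hA.isCrossedProduct.twistOrbit χ).ncard : K) *
      schurElement (t ∘ₗ S.val.toLinearMap) ψ := by
  have := hA.subalgebra.free_base
  have := hA.subalgebra.finite_base
  have := hA.subalgebra.module_free
  have := hA.subalgebra.module_finite
  have hT' := hA.subalgebra.symmetrizing.formExt (K := K)
  rw [formExt_comp_incl] at hT'
  rw [schurElement, schurElement, formExt_comp_incl]
  exact h.centralValue_dualElement hA.isCrossedProduct hC hB hA.symmetrizing.formExt hT'
    fun g hg b => hA.formExt_eq_zero hg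

end IsTwistedSymmetricAlgebra

end TwistedSymmetricAlgebra

end Clifford

end

open Clifford in
theorem mainTheorem8_general
    {𝒪 : Type*} [CommRing 𝒪] {K : Type w₁} [Field K] [Algebra 𝒪 K]
    {A : Type w₂} [Ring A] [Algebra 𝒪 A]
    {G : Type*} [Group G] [Finite G] [IsCyclic G] [DecidableEq G]
    (t : A →ₗ[𝒪] 𝒪) (S : Subalgebra 𝒪 A) (𝒜 : G → Submodule 𝒪 A)
    (hA : IsTwistedSymmetricAlgebra t S 𝒜)
    (hKA : IsSplitSemisimple K (K ⊗[𝒪] A))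
    (hKS : IsSplitSemisimple K (K ⊗[𝒪] S))
    (hKG : IsSplitSemisimple K (MonoidAlgebra K G)) :
    ∃ Φ : Orbits K S 𝒜 ≃ DualOrbits K 𝒜,
      ∀ (Ωbar : Orbits K S 𝒜) (Ω : DualOrbits K 𝒜), Φ Ωbar = Ω →
        (∑ᶠ ψ ∈ Ωbar.1, incl K S (block ψ) = ∑ᶠ χ ∈ Ω.1, block χ) ∧
        Ωbar.1.ncard * Ω.1.ncard = Nat.card G ∧
        (∀ χ ∈ Ω.1, χ ∘ₗ (incl K S).toLinearMap = ∑ᶠ ψ ∈ Ωbar.1, ψ) ∧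
        (∀ ψ ∈ Ωbar.1, ∀ (X : Type (max w₁ w₂)) [AddCommGroup X] [Module K X] [Module (K ⊗[𝒪] S) X]
          [IsScalarTower K (K ⊗[𝒪] S) X] [IsSimpleModule (K ⊗[𝒪] S) X],
          character K (K ⊗[𝒪] S) X = ψ →
            character K (K ⊗[𝒪] A) (Ind (incl K S) X) = ∑ᶠ χ ∈ Ω.1, χ) ∧
        (∀ χ ∈ Ω.1, ∀ ψ ∈ Ωbar.1,
          schurElement t χ = (Ω.1.ncard : K) * schurElement (t ∘ₗ S.val.toLinearMap) ψ) := by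
  have := hA.subalgebra.finite_base
  have := hA.subalgebra.module_finite
  have := hKG.hasEnoughRootsOfUnity
  have hd := hA.isCrossedProduct (K := K)
  obtain ⟨Φ, hΦ⟩ := hd.exists_equiv_orbits hKS hKA
  rw [Orbits, DualOrbits, Set.image_congr fun ψ hψ => hA.orbit_eq hKS hψ,
    Set.image_congr fun χ hχ => hA.dualOrbit_eq hχ]
  refine ⟨Φ, fun Ωbar Ω hΩ => ?_⟩
  obtain ⟨ψ₀, χ₀, h₀, hbar, hΩ'⟩ := hΦ Ωbar Ω hΩ
  rw [hbar, hΩ']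
  have hψ₀ {χ} (hχ : χ ∈ hd.twistOrbit χ₀) := (h₀.mem_twistOrbit_iff hKS hKA hd).1 hχ
  have hχ₀ {ψ} (hψ : ψ ∈ hd.conjOrbit ψ₀) := (h₀.mem_conjOrbit_iff hKS hKA hd).1 hψ
  refine ⟨h₀.finsum_ι_block hKS hKA hd, h₀.ncard_mul_ncard hKS hKA hd,
    fun χ hχ => (hψ₀ hχ).comp_eq_finsum hKS hKA hd,
    fun ψ hψ X _ _ _ _ _ hX => LiesOver.character_ind hKS hKA hd (hX ▸ hχ₀ hψ),
    fun χ hχ ψ hψ => ?_⟩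
  rw [← hd.twistOrbit_eq_of_mem hχ]
  exact hA.schurElement_eq hKS hKA (((hψ₀ hχ).mem_conjOrbit_iff hKS hKA hd).1 hψ)

open Clifford in
theorem mainTheorem8
    {𝒪 : Type*} [CommRing 𝒪] [IsDomain 𝒪] [IsNoetherianRing 𝒪] [IsIntegrallyClosed 𝒪]
    {F : Type*} [Field F] [Algebra 𝒪 F] [IsFractionRing 𝒪 F]
    {K : Type w₁} [Field K] [Algebra F K] [Algebra 𝒪 K] [IsScalarTower 𝒪 F K]
    [FiniteDimensional F K] [IsGalois F K]
    {A : Type w₂} [Ring A] [Algebra 𝒪 A] [Module.Free 𝒪 A] [Module.Finite 𝒪 A]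
    {G : Type*} [Group G] [Finite G] [IsCyclic G] [DecidableEq G]
    (t : A →ₗ[𝒪] 𝒪) (S : Subalgebra 𝒪 A) (𝒜 : G → Submodule 𝒪 A)
    (hA : IsTwistedSymmetricAlgebra t S 𝒜)
    (hKA : IsSplitSemisimple K (K ⊗[𝒪] A))
    (hKS : IsSplitSemisimple K (K ⊗[𝒪] S))
    (hKG : IsSplitSemisimple K (MonoidAlgebra K G)) :
    ∃ Φ : Orbits K S 𝒜 ≃ DualOrbits K 𝒜,
      ∀ (Ωbar : Orbits K S 𝒜) (Ω : DualOrbits K 𝒜), Φ Ωbar = Ω →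
        (∑ᶠ ψ ∈ Ωbar.1, incl K S (block ψ) = ∑ᶠ χ ∈ Ω.1, block χ) ∧
        Ωbar.1.ncard * Ω.1.ncard = Nat.card G ∧
        (∀ χ ∈ Ω.1, χ ∘ₗ (incl K S).toLinearMap = ∑ᶠ ψ ∈ Ωbar.1, ψ) ∧
        (∀ ψ ∈ Ωbar.1, ∀ (X : Type (max w₁ w₂)) [AddCommGroup X] [Module K X] [Module (K ⊗[𝒪] S) X]
          [IsScalarTower K (K ⊗[𝒪] S) X] [IsSimpleModule (K ⊗[𝒪] S) X],
          character K (K ⊗[𝒪] S) X = ψ →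
            character K (K ⊗[𝒪] A) (Ind (incl K S) X) = ∑ᶠ χ ∈ Ω.1, χ) ∧
        (∀ χ ∈ Ω.1, ∀ ψ ∈ Ωbar.1,
          schurElement t χ = (Ω.1.ncard : K) * schurElement (t ∘ₗ S.val.toLinearMap) ψ) :=
  mainTheorem8_general t S 𝒜 hA hKA hKS hKG
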